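/- Let $0<m<1$, $\nu>0$, and let $h:\mathbb{R}\to[0,\infty)$ be a probability density with $h(x)=0$ for $x<0$ that has a nonincreasing representative on $(0,\infty)$. Put $\check h(x)=h(-x)$, $$\rho_h(x)=\frac{h(|x|)-m(h*\check h)(x)}{2-m},\qquad p_n=\frac{(2n-2)!}{2^{2n-1}\,n!\,(n-1)!}\,\frac{[m(2-m)]^n}{m}\quad(n\ge 1).$$ Let $Y=\sum_{k=1}^{K}Y_k$, where $Y_1,Y_2,\dots$ are i.i.d. with density $\rho_h$, and $K$ is independent of them with $\mathbb{P}(K=n)=p_n$. Then $Y$ has an even probability density $\varphi_h$ on $\mathbb{R}$. Let $N$ be the stationary Poisson branching-cluster process on $\mathbb{R}$ with immigrant rate $\nu$ and offspring density $m\varphi_h$: immigrants form a homogeneous Poisson process of rate $\nu$; independently of the immigrants, each individual (immigrant or descendant) independently has a Poisson number of children with mean $m$, each displaced from its parent by an independent amount with density $\varphi_h$; and $N$ consists of the positions of all individuals. Let $\alpha_n$ denote the $n$-th factorial moment measure of $N$ (the expected sum over ordered $n$-tuples of distinct points), and let $\kappa_3$ be its third factorial cumulant measure, $$\kappa_3=\alpha_3-\alpha_2^{01}\otimes\alpha_1^{2}-\alpha_2^{02}\otimes\alpha_1^{1}-\alpha_2^{12}\otimes\alpha_1^{0}+2\,\alpha_1\otimes\alpha_1\otimes\alpha_1,$$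 where superscripts list the coordinates on which a factor acts. Then $N$ is reversible (its law is invariant under $x\mapsto -x$), $\alpha_1,\alpha_2,\alpha_3$ are locally finite, and the reduced third factorial cumulant measure of $N$ has a density in $L^1(\mathbb{R}^2)$: there is $c_3\in L^1(\mathbb{R}^2)$ such that $$\int F\,d\kappa_3=\int_{\mathbb{R}}\int_{\mathbb{R}^2}F(t,t+\tau_1,t+\tau_2)\,c_3(\tau_1,\tau_2)\,d\tau_1\,d\tau_2\,dt$$ for every bounded, compactly supported Borel function $F:\mathbb{R}^3\to\mathbb{R}$. Consequently the factorial bispectrum $$B(\omega_1,\omega_2)=\iint_{\mathbb{R}^2} c_3(\tau_1,\tau_2)\,e^{-\mathrm{i}(\omega_1\tau_1+\omega_2\tau_2)}\,d\tau_1\,d\tau_2$$ exists, and $B(\omega_1,\omega_2)\in\mathbb{R}$ for all $(\omega_1,\omega_2)\in\mathbb{R}^2$. -/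

import Mathlib

open MeasureTheory ProbabilityTheory Set
open scoped ENNReal NNReal

noncomputable section

namespace BranchingMatch

/-! ### The symmetric offspring law -/

/-- `h` is a probability density on the line, vanishing on the negative half-line, which has a
nonincreasing representative on `(0, ∞)`. -/
structure IsMonotoneKernel (h : ℝ → ℝ) : Prop where
  measurable : Measurable h
  nonneg : ∀ x, 0 ≤ h x
  lintegral_eq_one : ∫⁻ x, ENNReal.ofReal (h x) = 1
  eq_zero_of_neg : ∀ x, x < 0 → h x = 0
  exists_antitone : ∃ g : ℝ → ℝ, AntitoneOn g (Ioi 0) ∧ h =ᵐ[volume.restrict (Ioi 0)] g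

/-- `ρ_h(x) = (h(|x|) - m (h * ȟ)(x)) / (2 - m)`, with `ȟ(x) = h(-x)`. -/
def rho (m : ℝ) (h : ℝ → ℝ) (x : ℝ) : ℝ :=
  (h |x| - m * convolution h (fun y => h (-y)) (ContinuousLinearMap.mul ℝ ℝ) volume x) / (2 - m)

/-- `p_n = (2n-2)! / (2^(2n-1) n! (n-1)!) * (m (2-m))^n / m`, to be used for `n ≥ 1`. -/
def matchProb (m : ℝ) (n : ℕ) : ℝ :=
  ((2 * n - 2).factorial : ℝ) / (2 ^ (2 * n - 1) * (n.factorial : ℝ) * ((n - 1).factorial : ℝ))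
    * ((m * (2 - m)) ^ n / m)

/-- The `n`-fold convolution power: the law of a sum of `n` independent variables of law `μ`. -/
def convPow (μ : Measure ℝ) : ℕ → Measure ℝ
  | 0 => Measure.dirac 0
  | n + 1 => (convPow μ n).conv μ

/-- The law of `Y = Y_1 + ⋯ + Y_K`, where the `Y_k` are i.i.d. with density `ρ_h`, and `K ≥ 1` is
independent of them with `P(K = n) = p_n`. -/
def randomSumLaw (m : ℝ) (h : ℝ → ℝ) : Measure ℝ :=
  Measure.sum fun n : ℕ => ENNReal.ofReal (matchProb m (n + 1)) •
    convPow (volume.withDensity fun x => ENNReal.ofReal (rho m h x)) (n + 1)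

/-- `φ` is an even probability density of the law `μ`. -/
structure IsEvenDensityOf (φ : ℝ → ℝ) (μ : Measure ℝ) : Prop where
  measurable : Measurable φ
  nonneg : ∀ x, 0 ≤ φ x
  lintegral_eq_one : ∫⁻ x, ENNReal.ofReal (φ x) = 1
  even : ∀ x, φ (-x) = φ x
  eq_withDensity : μ = volume.withDensity fun x => ENNReal.ofReal (φ x)

/-! ### Point processes with labelled points -/

/-- A random family of points on the line with labels in `ι`: the point labelled `a` is present at
the outcomes `ω ∈ present a`, and then sits at `pos a ω`. -/
structure PointFamily (Ω ι : Type*) where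
  present : ι → Set Ω
  pos : ι → Ω → ℝ

variable {Ω : Type*} {ι : Type*}

/-- The counting measure of the points present (with multiplicity, should positions coincide). -/
def PointFamily.counting (X : PointFamily Ω ι) (ω : Ω) : Measure ℝ :=
  Measure.sum fun a : ι => (X.present a).indicator (fun ω => Measure.dirac (X.pos a ω)) ω

/-- The random measure `∑^{≠} δ_{(x_0, …, x_{n-1})}` on `ℝⁿ`, the sum ranging over the ordered
tuples of distinct points (that is, points with distinct labels). -/
def PointFamily.factorialPower (X : PointFamily Ω ι) (n : ℕ) (ω : Ω) : Measure (Fin n → ℝ) :=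
  Measure.sum fun a : Fin n ↪ ι =>
    (⋂ k, X.present (a k)).indicator (fun ω => Measure.dirac fun k => X.pos (a k) ω) ω

/-- The `n`-th factorial moment measure `α_n(B) = E ∑^{≠} 1_B(x_0, …, x_{n-1})`. -/
def PointFamily.factorialMoment [MeasurableSpace Ω] (X : PointFamily Ω ι) (P : Measure Ω) (n : ℕ) :
    Measure (Fin n → ℝ) :=
  P.bind (X.factorialPower n)

/-- `∫ F dκ_3`, for the third factorial cumulant measure
`κ_3 = α_3 - α_2^{01} ⊗ α_1^2 - α_2^{02} ⊗ α_1^1 - α_2^{12} ⊗ α_1^0 + 2 α_1 ⊗ α_1 ⊗ α_1`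
(superscripts list the coordinates on which a factor acts). -/
def PointFamily.thirdFactorialCumulant [MeasurableSpace Ω] (X : PointFamily Ω ι) (P : Measure Ω)
    (F : (Fin 3 → ℝ) → ℝ) : ℝ :=
  (∫ t, F t ∂(X.factorialMoment P 3))
    - (∫ y, ∫ x, F ![x 0, x 1, y 0] ∂(X.factorialMoment P 2) ∂(X.factorialMoment P 1))
    - (∫ y, ∫ x, F ![x 0, y 0, x 1] ∂(X.factorialMoment P 2) ∂(X.factorialMoment P 1))
    - (∫ y, ∫ x, F ![y 0, x 0, x 1] ∂(X.factorialMoment P 2) ∂(X.factorialMoment P 1))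
    + 2 * ∫ x, ∫ y, ∫ z, F ![x 0, y 0, z 0]
        ∂(X.factorialMoment P 1) ∂(X.factorialMoment P 1) ∂(X.factorialMoment P 1)

/-- The reduced third factorial cumulant measure of the point process has the density
`c ∈ L¹(ℝ²)`: the factorial moment measures up to order three are locally finite, and
`∫ F dκ_3 = ∫ ∫ F(t, t + τ_1, t + τ_2) c(τ_1, τ_2) dτ dt` for all bounded, compactly supported
Borel functions `F`. -/
structure PointFamily.HasThirdCumulantDensity [MeasurableSpace Ω] (X : PointFamily Ω ι)
    (P : Measure Ω) (c : ℝ × ℝ → ℝ) : Prop where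
  locallyFinite_one : IsLocallyFiniteMeasure (X.factorialMoment P 1)
  locallyFinite_two : IsLocallyFiniteMeasure (X.factorialMoment P 2)
  locallyFinite_three : IsLocallyFiniteMeasure (X.factorialMoment P 3)
  integrable : Integrable c
  cumulant_eq : ∀ F : (Fin 3 → ℝ) → ℝ, Measurable F → (∃ M : ℝ, ∀ t, |F t| ≤ M) →
    HasCompactSupport F →
      X.thirdFactorialCumulant P F
        = ∫ t : ℝ, ∫ τ : ℝ × ℝ, F ![t, t + τ.1, t + τ.2] * c τ

/-- The factorial bispectrum
`B(ω_1, ω_2) = ∫∫ c(τ_1, τ_2) exp(-i (ω_1 τ_1 + ω_2 τ_2)) dτ_1 dτ_2`. -/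
def bispectrum (c : ℝ × ℝ → ℝ) (w₁ w₂ : ℝ) : ℂ :=
  ∫ τ : ℝ × ℝ, (c τ : ℂ) * Complex.exp (-Complex.I * ((w₁ * τ.1 + w₂ * τ.2 : ℝ) : ℂ))

/-- A random measure on the line is reversible if its law is invariant under `x ↦ -x`. -/
def IsReversible [MeasurableSpace Ω] (P : Measure Ω) (N : Ω → Measure ℝ) : Prop :=
  Measurable N ∧ P.map (fun ω => (N ω).map fun x => -x) = P.map N

/-! ### Poisson branching-cluster processes -/

/-- `I` is a Poisson process on the line with intensity measure `Λ`. -/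
structure IsPoissonProcess [MeasurableSpace Ω] (P : Measure Ω) (I : Ω → Measure ℝ)
    (Λ : Measure ℝ) : Prop where
  measurable : Measurable I
  count : ∀ A : Set ℝ, MeasurableSet A → Λ A ≠ ∞ →
    P.map (fun ω => I ω A) = (poissonMeasure (Λ A).toNNReal).map fun n : ℕ => (n : ℝ≥0∞)
  indep : ∀ (n : ℕ) (A : Fin n → Set ℝ), (∀ i, MeasurableSet (A i)) →
    Pairwise (fun i j => Disjoint (A i) (A j)) → iIndepFun (fun i ω => I ω (A i)) P

/-- The vertices of a genealogical tree are named by words: `[]` is the root and `i :: v` is the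
`i`-th child of `v`. If every `v` has `K v` children, numbered from `0`, then `InTree K v` says
that the vertex `v` occurs in the tree. -/
def InTree (K : List ℕ → ℕ) : List ℕ → Prop
  | [] => True
  | i :: v => i < K v ∧ InTree K v

/-- The position of a vertex relative to the root, if `D v` is the displacement of `v` from its
parent (`D []` is not used). -/
def treePos (D : List ℕ → ℝ) : List ℕ → ℝ
  | [] => 0
  | i :: v => treePos D v + D (i :: v)

/-- The points of a branching-cluster process: the vertex `v` of the cluster of the `j`-th
immigrant, which arrives at `U j`, has `K (j, v)` children and displacement `D (j, v)` from its
parent. -/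
def clusterPoints (U : ℕ → Ω → ℝ) (K : ℕ × List ℕ → Ω → ℕ) (D : ℕ × List ℕ → Ω → ℝ) :
    PointFamily Ω (ℕ × List ℕ) where
  present a := {ω | InTree (fun v => K (a.1, v) ω) a.2}
  pos a ω := U a.1 ω + treePos (fun v => D (a.1, v) ω) a.2

/-- The data `U, K, D` on the probability space `(Ω, P)` generate the stationary Poisson
branching-cluster process with immigrant rate `ν` and offspring density `m φ`: immigrants form a
homogeneous Poisson process of rate `ν`; independently of it, each individual has a Poisson number
of children with mean `m`, displaced from it by independent amounts with density `φ`. -/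
structure IsBranchingClusterProcess [MeasurableSpace Ω] (P : Measure Ω) (ν m : ℝ) (φ : ℝ → ℝ)
    (U : ℕ → Ω → ℝ) (K : ℕ × List ℕ → Ω → ℕ) (D : ℕ × List ℕ → Ω → ℝ) : Prop where
  measurable_U : ∀ j, Measurable (U j)
  measurable_K : ∀ a, Measurable (K a)
  measurable_D : ∀ a, Measurable (D a)
  immigrants : IsPoissonProcess P (fun ω => Measure.sum fun j => Measure.dirac (U j ω))
    (ENNReal.ofReal ν • volume)
  marks_law : ∀ a, P.map (fun ω => (K a ω, D a ω))
    = (poissonMeasure m.toNNReal).prod (volume.withDensity fun x => ENNReal.ofReal (φ x))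
  marks_indep : iIndepFun (fun a ω => (K a ω, D a ω)) P
  immigrants_indep_marks : IndepFun (fun ω j => U j ω) (fun ω a => (K a ω, D a ω)) P

end BranchingMatch

end

/-!
The clusters of different immigrants are i.i.d. translates of the tree grown from one immigrant at
the origin. The factorial moment measures of the Poisson process of immigrants are the powers of its
intensity, so those of `N` are sums over the partitions of the coordinates into the groups that lie
in a common cluster. In the third factorial cumulant measure the terms with points in different
clusters cancel, so `κ₃` is `ν` times the third factorial moment measure of one cluster, integrated
over all translations. For `m < 1` the total progeny of an individual has a finite exponential
moment, so this measure is finite. Its reduction is absolutely continuous, because three distinct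
vertices of a tree are separated by two independent displacements that have densities. Flipping the
signs of all displacements preserves the law of the cluster when `φ` is even, so the reduced measure
is invariant under `τ ↦ -τ` and its Fourier transform, the bispectrum, is real. The same flip,
together with the reflection of the immigrants, gives reversibility through the Laplace functional
of the process.

As for the offspring law, `∑ p_n = 1` is an evaluation of the generating function of the Catalan
numbers, `ρ_h ≥ 0` follows from the monotonicity of `h`, and a density of the law of `Y` can be
averaged with its reflection.
-/

noncomputable section

namespace BranchingMatch

open scoped Function

/-! ### Factorial moments of Poisson processes -/

section FactorialMoments

lemma lintegral_poissonMeasure (r : ℝ≥0) (f : ℕ → ℝ≥0∞) :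
    ∫⁻ n, f n ∂poissonMeasure r
      = ∑' n : ℕ, ENNReal.ofReal (Real.exp (-r) * (r : ℝ) ^ n / n.factorial) * f n := by
  rw [poissonMeasure, lintegral_sum_measure]
  simp only [lintegral_smul_measure, lintegral_dirac, smul_eq_mul]

lemma lintegral_descFactorial_poissonMeasure (r : ℝ≥0) (k : ℕ) :
    ∫⁻ n, (n.descFactorial k : ℝ≥0∞) ∂poissonMeasure r = r ^ k := by
  have shift (n : ℕ) : Real.exp (-r) * (r : ℝ) ^ (n + k) / (n + k).factorial
      * (n + k).descFactorial k = r ^ k * (Real.exp (-r) * (r : ℝ) ^ n / n.factorial) := by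
    have factorial_eq : ((n + k).factorial : ℝ) = n.factorial * (n + k).descFactorial k := by
      rw [← Nat.factorial_mul_descFactorial (Nat.le_add_left k n), Nat.add_sub_cancel,
        Nat.cast_mul]
    have := Nat.cast_ne_zero (R := ℝ).2 ((Nat.descFactorial_eq_zero_iff_lt.not).2
      (Nat.le_add_left k n).not_gt)
    rw [factorial_eq, pow_add]
    field_simp
  have total : ∑' n : ℕ, ENNReal.ofReal (Real.exp (-r) * (r : ℝ) ^ n / n.factorial) = 1 := by
    simpa using (lintegral_poissonMeasure r fun _ => 1).symm
  rw [lintegral_poissonMeasure, ← ENNReal.summable.sum_add_tsum_nat_add' (k := k),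
    Finset.sum_eq_zero, zero_add]
  · calc ∑' n : ℕ, ENNReal.ofReal (Real.exp (-r) * (r : ℝ) ^ (n + k) / (n + k).factorial)
          * (n + k).descFactorial k
        = ∑' n : ℕ, (r : ℝ≥0∞) ^ k
          * ENNReal.ofReal (Real.exp (-r) * (r : ℝ) ^ n / n.factorial) := by
          refine tsum_congr fun n => ?_
          rw [← ENNReal.ofReal_natCast, ← ENNReal.ofReal_mul (by positivity), shift,
            ENNReal.ofReal_mul (by positivity), ENNReal.ofReal_pow r.coe_nonneg,
            ENNReal.ofReal_coe_nnreal]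
      _ = r ^ k := by rw [ENNReal.tsum_mul_left, total, mul_one]
  · intro n hn
    rw [Nat.descFactorial_of_lt (Finset.mem_range.1 hn), Nat.cast_zero, mul_zero]

/-- An injection whose value at `i` lies in `S (f i)` amounts to one injection into `S c` for each
fibre `f ⁻¹' {c}`: values of indices of different colours are automatically distinct, as the sets
`S c` are disjoint. -/
def embeddingEquivPi {ι κ β : Type*} {S : κ → Set β} (hS : Pairwise (Disjoint on S)) (f : ι → κ) :
    {a : ι ↪ β // ∀ i, a i ∈ S (f i)} ≃ ∀ c, {i // f i = c} ↪ S c where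
  toFun a c := ⟨fun i => ⟨a.1 i, by simpa only [i.2] using a.2 i⟩, fun i j hij =>
    Subtype.ext (a.1.injective (congrArg Subtype.val hij))⟩
  invFun g := ⟨⟨fun i => g (f i) ⟨i, rfl⟩, fun i j hij => by
    have injective_of_eq : ∀ {c d : κ}, c = d → ∀ (x : {i // f i = c}) (y : {i // f i = d}),
        (g c x : β) = g d y → (x : ι) = y := by
      rintro c _ rfl x y hxy
      exact congrArg Subtype.val ((g c).injective (Subtype.ext hxy))
    have hij' : (g (f i) ⟨i, rfl⟩ : β) = g (f j) ⟨j, rfl⟩ := hij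
    exact injective_of_eq (hS.eq (not_disjoint_iff.2
      ⟨_, (g (f i) ⟨i, rfl⟩).2, hij' ▸ (g (f j) ⟨j, rfl⟩).2⟩)) _ _ hij'⟩,
    fun i => (g (f i) ⟨i, rfl⟩).2⟩
  left_inv a := rfl
  right_inv g := by
    funext c
    ext ⟨i, hi⟩
    subst hi
    rfl

lemma encard_embedding_forall_mem {ι κ β : Type*} [Finite ι] [Fintype κ] {S : κ → Set β}
    (hS : Pairwise (Disjoint on S)) {N : κ → ℕ} (hN : ∀ c, (S c).encard = N c) (f : ι → κ) :
    {a : ι ↪ β | ∀ i, a i ∈ S (f i)}.encard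
      = (∏ c, (N c).descFactorial (Nat.card {i // f i = c}) : ℕ) := by
  classical
  have := Fintype.ofFinite ι
  have (c : κ) : Fintype (S c) := (finite_of_encard_eq_coe (hN c)).fintype
  have card_eq (c : κ) : Fintype.card (S c) = N c := by
    have := hN c
    rwa [encard_eq_coe_toFinset_card, toFinset_card, Nat.cast_inj] at this
  refine (ENat.card_congr (embeddingEquivPi hS f)).trans ?_
  rw [ENat.card_eq_coe_fintype_card, Fintype.card_pi]
  simp only [Fintype.card_embedding_eq, card_eq, Nat.card_eq_fintype_card]

lemma generateFrom_measurableSet_lt_top {α : Type*} [mα : MeasurableSpace α] (Λ : Measure α)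
    [SigmaFinite Λ] : MeasurableSpace.generateFrom {A | MeasurableSet A ∧ Λ A < ∞} = mα := by
  refine le_antisymm (MeasurableSpace.generateFrom_le fun A hA => hA.1) fun A hA => ?_
  rw [← inter_univ A, ← iUnion_spanningSets Λ, inter_iUnion]
  exact MeasurableSet.iUnion fun k => MeasurableSpace.measurableSet_generateFrom
    ⟨hA.inter (measurableSet_spanningSets Λ k),
      (measure_mono inter_subset_right).trans_lt (measure_spanningSets_lt_top Λ k)⟩

/-- Every box splits into boxes whose sides are atoms of the finite algebra generated by the sides
of the given one, and two such atoms are equal or disjoint. -/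
lemma eq_pi_of_forall_pairwise_disjoint {ι α : Type*} [Fintype ι] [MeasurableSpace α]
    {Λ : Measure α} [SigmaFinite Λ] {μ : Measure (ι → α)}
    (hμ : ∀ B : ι → Set α, (∀ i, MeasurableSet (B i)) → (∀ i, Λ (B i) ≠ ∞) →
      (∀ i j, B i ≠ B j → Disjoint (B i) (B j)) → μ (univ.pi B) = ∏ i, Λ (B i)) :
    μ = Measure.pi fun _ => Λ := by
  classical
  refine (Measure.pi_eq_generateFrom (C := fun _ => {A | MeasurableSet A ∧ Λ A < ∞})
    (fun _ => generateFrom_measurableSet_lt_top Λ)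
    (fun _ A hA B hB _ => ⟨hA.1.inter hB.1, (measure_mono inter_subset_left).trans_lt hA.2⟩)
    (fun _ => ⟨spanningSets Λ, fun k => ⟨measurableSet_spanningSets Λ k,
      measure_spanningSets_lt_top Λ k⟩, measure_spanningSets_lt_top Λ,
      iUnion_spanningSets Λ⟩) fun A hA => ?_).symm
  let label (x : α) : Set ι := {i | x ∈ A i}
  let atom (s : Set ι) : Set α := label ⁻¹' {s}
  have measurable_label : Measurable label := measurable_set_iff.2 fun i => (hA i).1.mem
  have measurableSet_atom (s : Set ι) : MeasurableSet (atom s) :=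
    measurable_label (measurableSet_singleton s)
  have measurableSet_box (c : ι → Set ι) : MeasurableSet (univ.pi fun i => atom (c i)) :=
    .univ_pi fun i => measurableSet_atom (c i)
  let T : Finset (ι → Set ι) := {c | ∀ i, i ∈ c i}
  have pi_eq_iUnion : univ.pi A = ⋃ c ∈ T, univ.pi fun i => atom (c i) := by
    ext x
    simp only [T, atom, mem_univ_pi, mem_iUnion, Finset.mem_filter_univ, mem_preimage,
      mem_singleton_iff, exists_prop]
    refine ⟨fun hx => ⟨fun i => label (x i), hx, fun i => rfl⟩, ?_⟩
    rintro ⟨c, hc, hx⟩ i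
    exact (hx i ▸ hc i : i ∈ label (x i))
  have measure_pi_eq_sum (ν : Measure (ι → α)) :
      ν (univ.pi A) = ∑ c ∈ T, ν (univ.pi fun i => atom (c i)) := by
    rw [pi_eq_iUnion, measure_biUnion_finset _ fun c _ => measurableSet_box c]
    intro c _ d _ hcd
    refine disjoint_left.2 fun x hc hd => hcd (funext fun i => ?_)
    exact (hc i (mem_univ i)).symm.trans (hd i (mem_univ i))
  rw [← Measure.pi_pi (fun _ => Λ), measure_pi_eq_sum μ, measure_pi_eq_sum]
  refine Finset.sum_congr rfl fun c hc => ?_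
  rw [Measure.pi_pi]
  refine hμ _ (fun i => measurableSet_atom _) (fun i => ?_) fun i j hij => ?_
  · have : atom (c i) ⊆ A i := fun x hx => by
      have : label x = c i := hx
      exact (this ▸ (Finset.mem_filter.1 hc).2 i : i ∈ label x)
    exact ((measure_mono this).trans_lt (hA i).2).ne
  · exact pairwise_disjoint_fiber label fun h => hij (congrArg atom h)

instance {ι α : Type*} [Countable α] [Finite ι] : Countable (ι ↪ α) :=
  DFunLike.coe_injective.countable

variable {Ω L : Type*} [MeasurableSpace Ω] {P : Measure Ω}

lemma sum_dirac_eq_encard {α : Type*} [MeasurableSpace α] (u : L → α) {A : Set α}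
    (hA : MeasurableSet A) : (Measure.sum fun j => Measure.dirac (u j)) A = (u ⁻¹' A).encard := by
  rw [Measure.sum_apply _ hA, ← ENNReal.tsum_set_one, tsum_subtype (u ⁻¹' A) fun _ => 1]
  exact tsum_congr fun j => Measure.dirac_apply' _ hA

variable {I : Ω → Measure ℝ} {Λ : Measure ℝ}

lemma IsPoissonProcess.ae_exists_eq_natCast (hI : IsPoissonProcess P I Λ) {A : Set ℝ}
    (hA : MeasurableSet A) (hΛ : Λ A ≠ ∞) : ∀ᵐ ω ∂P, ∃ n : ℕ, I ω A = n := by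
  have h_range : MeasurableSet {x : ℝ≥0∞ | ∃ n : ℕ, x = n} := by
    simpa only [range, eq_comm] using (countable_range ((↑) : ℕ → ℝ≥0∞)).measurableSet
  refine ae_of_ae_map ((Measure.measurable_coe hA).comp hI.measurable).aemeasurable
    (p := fun x : ℝ≥0∞ => ∃ n : ℕ, x = n) ?_
  change ∀ᵐ x : ℝ≥0∞ ∂P.map (fun ω => I ω A), ∃ n : ℕ, x = n
  rw [hI.count A hA hΛ, ae_map_iff (by fun_prop) h_range]
  exact .of_forall fun n => ⟨n, rfl⟩

lemma measurable_floor_descFactorial (k : ℕ) :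
    Measurable fun x : ℝ≥0∞ => (⌊x.toReal⌋₊.descFactorial k : ℝ≥0∞) :=
  Measurable.comp (g := fun n : ℕ => (n.descFactorial k : ℝ≥0∞)) .of_discrete
    (Nat.measurable_floor.comp ENNReal.measurable_toReal)

lemma IsPoissonProcess.lintegral_descFactorial (hI : IsPoissonProcess P I Λ) {A : Set ℝ}
    (hA : MeasurableSet A) (hΛ : Λ A ≠ ∞) (k : ℕ) :
    ∫⁻ ω, (⌊(I ω A).toReal⌋₊.descFactorial k : ℝ≥0∞) ∂P = Λ A ^ k := by
  rw [← lintegral_map (g := fun ω => I ω A) (measurable_floor_descFactorial k)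
      ((Measure.measurable_coe hA).comp hI.measurable),
    hI.count A hA hΛ, lintegral_map (measurable_floor_descFactorial k) .of_discrete]
  simp only [ENNReal.toReal_natCast, Nat.floor_natCast]
  rw [lintegral_descFactorial_poissonMeasure, ENNReal.coe_toNNReal hΛ]

lemma IsPoissonProcess.iIndepFun (hI : IsPoissonProcess P I Λ) {κ : Type*} [Finite κ]
    {C : κ → Set ℝ} (hC : ∀ c, MeasurableSet (C c)) (hdisj : Pairwise (Disjoint on C)) :
    iIndepFun (fun c ω => I ω (C c)) P := by
  obtain ⟨n, ⟨e⟩⟩ := Finite.exists_equiv_fin κ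
  exact iIndepFun.of_precomp e.symm.surjective
    (hI.indep n (C ∘ e.symm) (fun i => hC _) (hdisj.comp_of_injective e.symm.injective))

section Labelled

variable {U : L → Ω → ℝ} {ι : Type*} [Fintype ι]

lemma IsPoissonProcess.lintegral_encard_embedding [Countable L]
    (hI : IsPoissonProcess P (fun ω => Measure.sum fun j => Measure.dirac (U j ω)) Λ)
    {B : ι → Set ℝ} (hB : ∀ i, MeasurableSet (B i)) (hΛ : ∀ i, Λ (B i) ≠ ∞)
    (hdisj : ∀ i j, B i ≠ B j → Disjoint (B i) (B j)) :
    ∫⁻ ω, ({a : ι ↪ L | ∀ i, U (a i) ω ∈ B i}.encard : ℝ≥0∞) ∂P = ∏ i, Λ (B i) := by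
  classical
  let f : ι → range B := rangeFactorization B
  have hBr (c : range B) : MeasurableSet (c : Set ℝ) := by obtain ⟨_, i, rfl⟩ := c; exact hB i
  have hΛr (c : range B) : Λ c ≠ ∞ := by obtain ⟨_, i, rfl⟩ := c; exact hΛ i
  have hdisjr : Pairwise (Disjoint on ((↑) : range B → Set ℝ)) := by
    rintro ⟨_, i, rfl⟩ ⟨_, j, rfl⟩ hij
    exact hdisj i j fun h => hij (Subtype.ext h)
  have encard_eq : ∀ᵐ ω ∂P, ({a : ι ↪ L | ∀ i, U (a i) ω ∈ B i}.encard : ℝ≥0∞)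
      = ∏ c : range B, (⌊((Measure.sum fun j => Measure.dirac (U j ω)) c).toReal⌋₊.descFactorial
        (Nat.card {i // f i = c}) : ℝ≥0∞) := by
    filter_upwards [ae_all_iff.2 fun c : range B => hI.ae_exists_eq_natCast (hBr c) (hΛr c)]
      with ω hω
    choose N hN using hω
    have encard_preimage (c : range B) : {j | U j ω ∈ (c : Set ℝ)}.encard = N c := by
      have := (sum_dirac_eq_encard (fun j => U j ω) (hBr c)).symm.trans (hN c)
      exact_mod_cast this
    have encard_embedding := encard_embedding_forall_mem
      (fun c d hcd => (hdisjr hcd).preimage fun j => U j ω) encard_preimage f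
    simp only [hN, ENNReal.toReal_natCast, Nat.floor_natCast]
    rw [← Nat.cast_prod]
    exact congrArg ((↑) : ℕ∞ → ℝ≥0∞) encard_embedding
  calc ∫⁻ ω, ({a : ι ↪ L | ∀ i, U (a i) ω ∈ B i}.encard : ℝ≥0∞) ∂P
      = ∏ c : range B, ∫⁻ ω, (⌊((Measure.sum fun j => Measure.dirac (U j ω))
          c).toReal⌋₊.descFactorial (Nat.card {i // f i = c}) : ℝ≥0∞) ∂P := by
        rw [lintegral_congr_ae encard_eq]
        exact lintegral_prod_eq_prod_lintegral_of_indepFun Finset.univ _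
          ((hI.iIndepFun hBr hdisjr).comp _ fun c => measurable_floor_descFactorial _)
          fun c => (measurable_floor_descFactorial _).comp
            ((Measure.measurable_coe (hBr c)).comp hI.measurable)
    _ = ∏ c : range B, Λ c ^ Nat.card {i // f i = c} :=
        Finset.prod_congr rfl fun c _ => hI.lintegral_descFactorial (hBr c) (hΛr c) _
    _ = ∏ i, Λ (B i) := by
        rw [← Finset.prod_fiberwise _ f fun i => Λ (B i)]
        refine Finset.prod_congr rfl fun c _ => ?_
        rw [Nat.card_eq_fintype_card, Fintype.card_subtype]
        exact (Finset.prod_eq_pow_card fun i hi => congrArg (fun c : range B => Λ c)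
          (Finset.mem_filter.1 hi).2).symm

lemma IsPoissonProcess.sum_map_embedding [Countable L] [SigmaFinite Λ]
    (hU : ∀ j, Measurable (U j))
    (hI : IsPoissonProcess P (fun ω => Measure.sum fun j => Measure.dirac (U j ω)) Λ) :
    (Measure.sum fun a : ι ↪ L => P.map fun ω i => U (a i) ω) = Measure.pi fun _ => Λ := by
  refine eq_pi_of_forall_pairwise_disjoint fun B hB hΛ hdisj => ?_
  have measurableSet_event (a : ι ↪ L) : MeasurableSet {ω | ∀ i, U (a i) ω ∈ B i} :=
    ofPred_forall (fun i ω => U (a i) ω ∈ B i) ▸ .iInter fun i => hU _ (hB i)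
  calc (Measure.sum fun a : ι ↪ L => P.map fun ω i => U (a i) ω) (univ.pi B)
      = ∑' a : ι ↪ L, P {ω | ∀ i, U (a i) ω ∈ B i} := by
        rw [Measure.sum_apply _ (.univ_pi hB)]
        refine tsum_congr fun a => ?_
        rw [Measure.map_apply (measurable_pi_lambda _ fun i => hU _) (.univ_pi hB)]
        simp only [preimage, mem_univ_pi]
    _ = ∫⁻ ω, ∑' a : ι ↪ L, {ω | ∀ i, U (a i) ω ∈ B i}.indicator 1 ω ∂P := by
        rw [lintegral_tsum fun a => (measurable_one.indicator (measurableSet_event a)).aemeasurable]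
        exact tsum_congr fun a => (lintegral_indicator_one (measurableSet_event a)).symm
    _ = ∫⁻ ω, ({a : ι ↪ L | ∀ i, U (a i) ω ∈ B i}.encard : ℝ≥0∞) ∂P := by
        refine lintegral_congr fun ω => ?_
        rw [← ENNReal.tsum_set_one, tsum_subtype {a : ι ↪ L | ∀ i, U (a i) ω ∈ B i} fun _ => 1]
        rfl
    _ = ∏ i, Λ (B i) := hI.lintegral_encard_embedding hB hΛ hdisj

end Labelled

end FactorialMoments

/-! ### Factorial moments of superpositions -/

section Superposition

section Sums

variable {α : Type*}

open Classical in
lemma tsum_embedding_comp {ι κ : Type*} {p : ι → κ} (hp : p.Surjective) (G : (ι → α) → ℝ≥0∞) :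
    ∑' b : κ ↪ α, G (b ∘ p) = ∑' J, if ∀ i j, J i = J j ↔ p i = p j then G J else 0 := by
  have injective_comp : Function.Injective fun b : κ ↪ α => b ∘ p := fun b c h =>
    DFunLike.coe_injective (hp.injective_comp_right h)
  have range_comp : range (fun b : κ ↪ α => b ∘ p) = {J | ∀ i j, J i = J j ↔ p i = p j} := by
    refine subset_antisymm (range_subset_iff.2 fun b i j => b.injective.eq_iff) fun J hJ => ?_
    have lift_apply (i : ι) : J (Function.surjInv hp (p i)) = J i :=
      (hJ _ _).2 (Function.surjInv_eq hp _)
    refine ⟨⟨fun c => J (Function.surjInv hp c), fun c d hcd => ?_⟩, funext lift_apply⟩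
    simpa only [Function.surjInv_eq] using (hJ _ _).1 hcd
  rw [← tsum_range G injective_comp, range_comp, tsum_subtype]
  simp only [indicator_apply, mem_ofPred_eq]

lemma tsum_embedding {ι : Type*} [DecidablePred fun J : ι → α => J.Injective]
    (G : (ι → α) → ℝ≥0∞) :
    ∑' b : ι ↪ α, G b = ∑' J, if J.Injective then G J else 0 := by
  classical
  refine (tsum_embedding_comp Function.surjective_id G).trans (tsum_congr fun J => ?_)
  refine if_congr ⟨fun h i j => (h i j).1, fun h i j => h.eq_iff⟩ rfl rfl

lemma tsum_fin_one_fun (G : (Fin 1 → α) → ℝ≥0∞) : ∑' v, G v = ∑' x, G ![x] :=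
  ((Equiv.funUnique (Fin 1) α).symm.tsum_eq G).symm.trans
    (tsum_congr fun x => congrArg G (Matrix.vec_single_eq_const x).symm)

lemma tsum_fin_two_fun (G : (Fin 2 → α) → ℝ≥0∞) : ∑' v, G v = ∑' x, ∑' y, G ![x, y] := by
  rw [← (finTwoArrowEquiv α).symm.tsum_eq G, ENNReal.tsum_prod']
  rfl

lemma tsum_fin_three_fun (G : (Fin 3 → α) → ℝ≥0∞) :
    ∑' v, G v = ∑' x, ∑' y, ∑' z, G ![x, y, z] := by
  rw [← (Fin.consEquiv fun _ => α).tsum_eq G, ENNReal.tsum_prod']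
  exact tsum_congr fun x => tsum_fin_two_fun fun v => G (Fin.cons x v)

lemma tsum_fin_one_fun_eq (G : (Fin 1 → α) → ℝ≥0∞) :
    ∑' J, G J = ∑' b : Fin 1 ↪ α, G (b ∘ fun _ => 0) := by
  classical
  rw [tsum_embedding_comp (by decide) G]
  refine tsum_congr fun J => (if_pos fun i j => ?_).symm
  simp only [Subsingleton.elim i j]

lemma tsum_fin_two_fun_eq_add (G : (Fin 2 → α) → ℝ≥0∞) :
    ∑' J, G J = ∑' b : Fin 1 ↪ α, G (b ∘ fun _ => 0) + ∑' b : Fin 2 ↪ α, G (b ∘ id) := by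
  classical
  rw [tsum_embedding_comp (by decide) G, tsum_embedding_comp (by decide) G, ← ENNReal.tsum_add]
  refine tsum_congr fun J => ?_
  by_cases h : J 0 = J 1 <;>
    simp [Fin.forall_fin_two, h, eq_comm (a := J 1)]

lemma tsum_fin_three_fun_eq_add (G : (Fin 3 → α) → ℝ≥0∞) :
    ∑' J, G J = ∑' b : Fin 1 ↪ α, G (b ∘ fun _ => 0) + ∑' b : Fin 2 ↪ α, G (b ∘ ![0, 0, 1])
      + ∑' b : Fin 2 ↪ α, G (b ∘ ![0, 1, 0]) + ∑' b : Fin 2 ↪ α, G (b ∘ ![1, 0, 0])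
      + ∑' b : Fin 3 ↪ α, G (b ∘ id) := by
  classical
  rw [tsum_embedding_comp (by decide) G, tsum_embedding_comp (by decide) G,
    tsum_embedding_comp (by decide) G, tsum_embedding_comp (by decide) G,
    tsum_embedding_comp (by decide) G]
  simp only [← ENNReal.tsum_add]
  refine tsum_congr fun J => ?_
  by_cases h01 : J 0 = J 1 <;> by_cases h02 : J 0 = J 2 <;> by_cases h12 : J 1 = J 2 <;>
    simp_all [Fin.forall_fin_succ, eq_comm (a := J 1) (b := J 0),
      eq_comm (a := J 2) (b := J 0), eq_comm (a := J 2) (b := J 1)]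

lemma injective_fin_two_iff {f : Fin 2 → α} : f.Injective ↔ f 0 ≠ f 1 := by
  simp [Function.Injective, Fin.forall_fin_two, eq_comm (a := f 1)]

lemma injective_fin_three_iff {f : Fin 3 → α} :
    f.Injective ↔ f 0 ≠ f 1 ∧ f 0 ≠ f 2 ∧ f 1 ≠ f 2 := by
  simp only [Function.Injective, Fin.forall_fin_succ, Fin.forall_fin_zero]
  grind

lemma ite_tsum_zero (p : Prop) [Decidable p] (f : α → ℝ≥0∞) :
    (if p then ∑' a, f a else 0) = ∑' a, if p then f a else 0 := by
  split_ifs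
  · rfl
  · exact tsum_zero.symm

end Sums

section Families

variable {E V : Type*}

open Classical in
lemma PointFamily.lintegral_factorialPower (X : PointFamily E V) (n : ℕ) (F : (Fin n → ℝ) → ℝ≥0∞)
    (y : E) : ∫⁻ x, F x ∂X.factorialPower n y = ∑' v : Fin n → V,
      if v.Injective ∧ ∀ k, y ∈ X.present (v k) then F fun k => X.pos (v k) y else 0 := by
  rw [PointFamily.factorialPower, lintegral_sum_measure]
  simp only [ite_and]
  refine Eq.trans (tsum_congr fun v => ?_) (tsum_embedding fun v =>
    if ∀ k, y ∈ X.present (v k) then F fun k => X.pos (v k) y else 0)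
  by_cases h : y ∈ ⋂ k, X.present (v k)
  · rw [indicator_of_mem h, lintegral_dirac, if_pos (mem_iInter.1 h)]
  · rw [indicator_of_notMem h, lintegral_zero_measure, if_neg (mt mem_iInter.2 h)]

open Classical in
/-- The sum of `F` over the tuples of distinct points whose `k`-th entry comes from the
configuration of `C` at the outcome `y (p k)`; points from configurations with different indices
are distinct. -/
def PointFamily.jointSum (C : PointFamily E V) {n : ℕ} {κ : Type*} (p : Fin n → κ)
    (F : (Fin n → ℝ) → ℝ≥0∞) (y : κ → E) : ℝ≥0∞ :=
  ∑' v : Fin n → V, if (fun k => (p k, v k)).Injective ∧ ∀ k, y (p k) ∈ C.present (v k)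
    then F fun k => C.pos (v k) (y (p k)) else 0

lemma PointFamily.jointSum_comp (C : PointFamily E V) {n : ℕ} {κ L : Type*} (b : κ ↪ L)
    (p : Fin n → κ) (F : (Fin n → ℝ) → ℝ≥0∞) (y : L → E) :
    C.jointSum (b ∘ p) F y = C.jointSum p F (y ∘ b) := by
  classical
  refine tsum_congr fun v => if_congr (and_congr_left' ?_) rfl rfl
  exact (b.injective.prodMap Function.injective_id).of_comp_iff fun k => (p k, v k)

lemma PointFamily.jointSum_const (C : PointFamily E V) {n : ℕ} {κ : Type*} (c : κ)
    (F : (Fin n → ℝ) → ℝ≥0∞) (y : κ → E) :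
    C.jointSum (fun _ => c) F y = ∫⁻ x, F x ∂C.factorialPower n (y c) := by
  classical
  rw [C.lintegral_factorialPower]
  refine tsum_congr fun v => if_congr (and_congr_left' ?_) rfl rfl
  exact (Prod.mk_right_injective c).of_comp_iff v

instance [Countable V] (C : PointFamily E V) (n : ℕ) (y : E) : SFinite (C.factorialPower n y) := by
  have (v : Fin n ↪ V) : SFinite ((⋂ k, C.present (v k)).indicator
      (fun y => Measure.dirac fun k => C.pos (v k) y) y) := by
    classical
    rw [indicator_apply]
    split_ifs <;> infer_instance
  rw [PointFamily.factorialPower]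
  infer_instance

section Patterns

variable (C : PointFamily E V) [Countable V]

lemma PointFamily.jointSum_zero_one {F : (Fin 2 → ℝ) → ℝ≥0∞} (hF : Measurable F) (y : Fin 2 → E) :
    C.jointSum id F y
      = ∫⁻ q, F ![q.1 0, q.2 0] ∂(C.factorialPower 1 (y 0)).prod (C.factorialPower 1 (y 1)) := by
  classical
  rw [lintegral_prod _ (by fun_prop), PointFamily.jointSum, tsum_fin_two_fun]
  simp only [C.lintegral_factorialPower, tsum_fin_one_fun, ite_tsum_zero, ← ite_and]
  refine tsum_congr fun u => tsum_congr fun v => ?_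
  refine ite_congr (propext ?_) (fun _ => congrArg F ?_) fun _ => rfl
  · simp [injective_fin_two_iff, Function.injective_of_subsingleton]
  · ext k
    fin_cases k <;> rfl

lemma PointFamily.jointSum_zero_zero_one {F : (Fin 3 → ℝ) → ℝ≥0∞} (hF : Measurable F)
    (y : Fin 2 → E) : C.jointSum ![0, 0, 1] F y = ∫⁻ q, F ![q.1 0, q.1 1, q.2 0]
      ∂(C.factorialPower 2 (y 0)).prod (C.factorialPower 1 (y 1)) := by
  classical
  rw [lintegral_prod _ (by fun_prop), PointFamily.jointSum, tsum_fin_three_fun]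
  simp only [C.lintegral_factorialPower, tsum_fin_one_fun, tsum_fin_two_fun, ite_tsum_zero,
    ← ite_and]
  refine tsum_congr fun u => tsum_congr fun v => tsum_congr fun w => ?_
  refine ite_congr (propext ?_) (fun _ => congrArg F ?_) fun _ => rfl
  · simp [injective_fin_three_iff, injective_fin_two_iff, Fin.forall_fin_succ,
      Function.injective_of_subsingleton, and_assoc, and_comm]
  · ext k
    fin_cases k <;> rfl

lemma PointFamily.jointSum_zero_one_zero {F : (Fin 3 → ℝ) → ℝ≥0∞} (hF : Measurable F)
    (y : Fin 2 → E) : C.jointSum ![0, 1, 0] F y = ∫⁻ q, F ![q.1 0, q.2 0, q.1 1]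
      ∂(C.factorialPower 2 (y 0)).prod (C.factorialPower 1 (y 1)) := by
  classical
  rw [lintegral_prod _ (by fun_prop), PointFamily.jointSum, tsum_fin_three_fun]
  simp only [C.lintegral_factorialPower, tsum_fin_one_fun, tsum_fin_two_fun, ite_tsum_zero,
    ← ite_and]
  refine tsum_congr fun u => ENNReal.tsum_comm.trans (tsum_congr fun v => tsum_congr fun w => ?_)
  refine ite_congr (propext ?_) (fun _ => congrArg F ?_) fun _ => rfl
  · simp [injective_fin_three_iff, injective_fin_two_iff, Fin.forall_fin_succ,
      Function.injective_of_subsingleton, and_assoc, and_comm]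
  · ext k
    fin_cases k <;> rfl

lemma PointFamily.jointSum_one_zero_zero {F : (Fin 3 → ℝ) → ℝ≥0∞} (hF : Measurable F)
    (y : Fin 2 → E) : C.jointSum ![1, 0, 0] F y = ∫⁻ q, F ![q.2 0, q.1 0, q.1 1]
      ∂(C.factorialPower 2 (y 0)).prod (C.factorialPower 1 (y 1)) := by
  classical
  rw [lintegral_prod_symm _ (by fun_prop), PointFamily.jointSum, tsum_fin_three_fun]
  simp only [C.lintegral_factorialPower, tsum_fin_one_fun, tsum_fin_two_fun, ite_tsum_zero,
    ← ite_and]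
  refine tsum_congr fun u => tsum_congr fun v => tsum_congr fun w => ?_
  refine ite_congr (propext ?_) (fun _ => congrArg F ?_) fun _ => rfl
  · simp [injective_fin_three_iff, injective_fin_two_iff, Fin.forall_fin_succ,
      Function.injective_of_subsingleton, and_left_comm]
  · ext k
    fin_cases k <;> rfl

lemma PointFamily.jointSum_zero_one_two {F : (Fin 3 → ℝ) → ℝ≥0∞} (hF : Measurable F)
    (y : Fin 3 → E) : C.jointSum id F y = ∫⁻ q, F ![q.1 0, q.2.1 0, q.2.2 0]
      ∂(C.factorialPower 1 (y 0)).prod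
        ((C.factorialPower 1 (y 1)).prod (C.factorialPower 1 (y 2))) := by
  classical
  rw [lintegral_prod _ (by fun_prop), PointFamily.jointSum, tsum_fin_three_fun]
  conv_rhs => enter [2, x]; rw [lintegral_prod _ (by fun_prop)]
  simp only [C.lintegral_factorialPower, tsum_fin_one_fun, ite_tsum_zero, ← ite_and]
  refine tsum_congr fun u => tsum_congr fun v => tsum_congr fun w => ?_
  refine ite_congr (propext ?_) (fun _ => congrArg F ?_) fun _ => rfl
  · simp [injective_fin_three_iff, Function.injective_of_subsingleton, Fin.forall_fin_succ]
  · ext k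
    fin_cases k <;> rfl

end Patterns

variable [MeasurableSpace E]

/-- The points of `X` have measurable positions and are present at measurable sets of outcomes. -/
structure PointFamily.IsMeasurable (X : PointFamily E V) : Prop where
  measurableSet_present : ∀ a, MeasurableSet (X.present a)
  measurable_pos : ∀ a, Measurable (X.pos a)

lemma measurable_measure_sum {ι α : Type*} [Countable ι] [MeasurableSpace α]
    {f : ι → E → Measure α} (hf : ∀ i, Measurable (f i)) :
    Measurable fun y => Measure.sum fun i => f i y := by
  refine Measure.measurable_of_measurable_coe _ fun A hA => ?_
  simp only [Measure.sum_apply _ hA]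
  exact Measurable.tsum fun i => (Measure.measurable_coe hA).comp (hf i)

lemma PointFamily.IsMeasurable.measurable_factorialPower [Countable V] {X : PointFamily E V}
    (hX : X.IsMeasurable) (n : ℕ) : Measurable (X.factorialPower n) :=
  measurable_measure_sum fun v => (Measure.measurable_dirac.comp
    (measurable_pi_lambda _ fun k => hX.measurable_pos (v k))).indicator
      (.iInter fun k => hX.measurableSet_present (v k))

lemma PointFamily.IsMeasurable.measurable_counting [Countable V] {X : PointFamily E V}
    (hX : X.IsMeasurable) : Measurable X.counting :=
  measurable_measure_sum fun v =>
    (Measure.measurable_dirac.comp (hX.measurable_pos v)).indicator (hX.measurableSet_present v)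

/-- The factorial powers of the configuration of `X`, as a kernel. -/
def PointFamily.IsMeasurable.factorialKernel [Countable V] {X : PointFamily E V}
    (hX : X.IsMeasurable) (n : ℕ) : Kernel E (Fin n → ℝ) :=
  ⟨X.factorialPower n, hX.measurable_factorialPower n⟩

instance [Countable V] {X : PointFamily E V} (hX : X.IsMeasurable) (n : ℕ) :
    IsSFiniteKernel (hX.factorialKernel n) := by
  classical
  have h : hX.factorialKernel n = Kernel.sum fun v : Fin n ↪ V => Kernel.piecewise
      (MeasurableSet.iInter fun k => hX.measurableSet_present (v k))
      (Kernel.deterministic (fun y k => X.pos (v k) y)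
        (measurable_pi_lambda _ fun k => hX.measurable_pos _)) 0 := by
    ext1 y
    refine (congrArg Measure.sum (funext fun v => ?_)).trans (Kernel.sum_apply _ y).symm
    rw [Kernel.piecewise_apply]
    rfl
  rw [h]
  infer_instance

lemma prod_comp_comp {A B α β : Type*} [MeasurableSpace A] [MeasurableSpace B]
    [MeasurableSpace α] [MeasurableSpace β] (κ : Kernel A α) (η : Kernel B β) [IsSFiniteKernel κ]
    [IsSFiniteKernel η] (μ : Measure A) (ν : Measure B) [SFinite μ] [SFinite ν] :
    (κ ∘ₘ μ).prod (η ∘ₘ ν) = (κ ∥ₖ η) ∘ₘ (μ.prod ν) := by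
  rw [Measure.prod_comp_left, Measure.prod_comp_right, Measure.comp_assoc,
    Kernel.parallelComp_comp_parallelComp, Kernel.comp_id, Kernel.id_comp]

lemma PointFamily.IsMeasurable.measurable_jointSum [Countable V] {C : PointFamily E V}
    (hC : C.IsMeasurable) {n : ℕ} {κ : Type*} (p : Fin n → κ) {F : (Fin n → ℝ) → ℝ≥0∞}
    (hF : Measurable F) : Measurable (C.jointSum p F) := by
  refine Measurable.tsum fun v => Measurable.ite ?_ ?_ measurable_const
  · rw [ofPred_and, ofPred_forall]
    refine (MeasurableSet.const _).inter (.iInter fun k => ?_)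
    exact measurable_pi_apply (p k) (hC.measurableSet_present (v k))
  · exact hF.comp (measurable_pi_lambda _ fun k =>
      (hC.measurable_pos _).comp (measurable_pi_apply _))

end Families

section LocallyFinite

instance isLocallyFiniteMeasure_add {X : Type*} [TopologicalSpace X] [MeasurableSpace X]
    (μ ν : Measure X) [IsLocallyFiniteMeasure μ] [IsLocallyFiniteMeasure ν] :
    IsLocallyFiniteMeasure (μ + ν) := by
  refine ⟨fun x => ?_⟩
  obtain ⟨s, hs, hμs⟩ := μ.finiteAt_nhds x
  obtain ⟨t, ht, hνt⟩ := ν.finiteAt_nhds x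
  refine ⟨s ∩ t, Filter.inter_mem hs ht, ENNReal.add_lt_top.2 ⟨?_, ?_⟩⟩
  · exact (measure_mono inter_subset_left).trans_lt hμs
  · exact (measure_mono inter_subset_right).trans_lt hνt

lemma isLocallyFiniteMeasure_map_of_norm_le {X Y : Type*} [NormedAddCommGroup X] [ProperSpace X]
    [MeasurableSpace X] [NormedAddCommGroup Y] [MeasurableSpace Y] [OpensMeasurableSpace Y]
    {e : X → Y} (he : Measurable e) (norm_le : ∀ x, ‖x‖ ≤ ‖e x‖) (μ : Measure X)
    [IsLocallyFiniteMeasure μ] : IsLocallyFiniteMeasure (μ.map e) := by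
  refine ⟨fun y => ⟨Metric.ball 0 (‖y‖ + 1), Metric.isOpen_ball.mem_nhds (by simp), ?_⟩⟩
  rw [Measure.map_apply he measurableSet_ball]
  refine (measure_mono fun x hx => ?_).trans_lt
    (isCompact_closedBall (0 : X) (‖y‖ + 1)).measure_lt_top
  rw [mem_closedBall_zero_iff]
  exact (norm_le x).trans (mem_ball_zero_iff.1 hx).le

lemma integrable_of_bounded_of_hasCompactSupport {X : Type*} [TopologicalSpace X]
    [MeasurableSpace X] {μ : Measure X} [IsLocallyFiniteMeasure μ] {F : X → ℝ}
    (hF : Measurable F) (bounded : ∃ M : ℝ, ∀ t, |F t| ≤ M) (hc : HasCompactSupport F) :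
    Integrable F μ := by
  obtain ⟨M, hM⟩ := bounded
  rw [← integrableOn_iff_integrable_of_support_subset (subset_tsupport F)]
  exact Measure.integrableOn_of_bounded (M := M) hc.isCompact.measure_lt_top.ne
    hF.aestronglyMeasurable (.of_forall hM)

lemma integral_integral_eq_integral_map {X Y Z : Type*} [MeasurableSpace X] [MeasurableSpace Y]
    [MeasurableSpace Z] {μ : Measure X} {ν : Measure Y} [SFinite μ] [SFinite ν] {e : X × Y → Z}
    (he : Measurable e) {F : Z → ℝ} (hF : Integrable F ((μ.prod ν).map e)) :
    ∫ y, ∫ x, F (e (x, y)) ∂μ ∂ν = ∫ z, F z ∂(μ.prod ν).map e :=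
  ((integral_map he.aemeasurable hF.aestronglyMeasurable).trans
    (integral_prod_symm _ (hF.comp_measurable he))).symm

end LocallyFinite

section ThirdCumulant

lemma norm_vec_three (a b c : ℝ) : ‖![a, b, c]‖ = max ‖a‖ (max ‖b‖ ‖c‖) := by
  simp [Pi.norm_def, Fin.univ_succ]

lemma norm_fin_two_prod (q : (Fin 2 → ℝ) × (Fin 1 → ℝ)) :
    ‖q‖ = max (max ‖q.1 0‖ ‖q.1 1‖) ‖q.2 0‖ := by
  simp [Prod.norm_def, Pi.norm_def, Fin.univ_succ]

variable {α₁ : Measure (Fin 1 → ℝ)} [IsLocallyFiniteMeasure α₁] {β : Measure (Fin 2 → ℝ)}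
  [IsLocallyFiniteMeasure β]

instance : IsLocallyFiniteMeasure ((α₁.prod α₁).map fun q => ![q.1 0, q.2 0]) :=
  isLocallyFiniteMeasure_map_of_norm_le (by fun_prop) (fun q => by
    simp [Prod.norm_def, Pi.norm_def, Fin.univ_succ]) _

instance : IsLocallyFiniteMeasure
    ((α₁.prod (α₁.prod α₁)).map fun q => ![q.1 0, q.2.1 0, q.2.2 0]) :=
  isLocallyFiniteMeasure_map_of_norm_le (by fun_prop) (fun q => by
    simp [Prod.norm_def, Pi.norm_def, Fin.univ_succ]) _

instance : IsLocallyFiniteMeasure ((β.prod α₁).map fun q => ![q.1 0, q.1 1, q.2 0]) :=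
  isLocallyFiniteMeasure_map_of_norm_le (by fun_prop) (fun q => le_of_eq <| by
    rw [norm_fin_two_prod, norm_vec_three]
    ac_rfl) _

instance : IsLocallyFiniteMeasure ((β.prod α₁).map fun q => ![q.1 0, q.2 0, q.1 1]) :=
  isLocallyFiniteMeasure_map_of_norm_le (by fun_prop) (fun q => le_of_eq <| by
    rw [norm_fin_two_prod, norm_vec_three]
    ac_rfl) _

instance : IsLocallyFiniteMeasure ((β.prod α₁).map fun q => ![q.2 0, q.1 0, q.1 1]) :=
  isLocallyFiniteMeasure_map_of_norm_le (by fun_prop) (fun q => le_of_eq <| by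
    rw [norm_fin_two_prod, norm_vec_three]
    ac_rfl) _

lemma lintegral_map_prod_pair_prod {e : (Fin 2 → ℝ) × (Fin 1 → ℝ) → Fin 3 → ℝ}
    (he : Measurable e) {F : (Fin 3 → ℝ) → ℝ≥0∞} (hF : Measurable F) :
    ∫⁻ x, F x ∂(((α₁.prod α₁).map fun q => ![q.1 0, q.2 0]).prod α₁).map e
      = ∫⁻ x, ∫⁻ y, ∫⁻ z, F (e (![x 0, y 0], z)) ∂α₁ ∂α₁ ∂α₁ := by
  rw [lintegral_map hF he, lintegral_prod _ (by fun_prop),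
    lintegral_map (by fun_prop) (by fun_prop), lintegral_prod _ (by fun_prop)]

lemma lintegral_map_triple {F : (Fin 3 → ℝ) → ℝ≥0∞} (hF : Measurable F) :
    ∫⁻ x, F x ∂(α₁.prod (α₁.prod α₁)).map (fun q => ![q.1 0, q.2.1 0, q.2.2 0])
      = ∫⁻ x, ∫⁻ y, ∫⁻ z, F ![x 0, y 0, z 0] ∂α₁ ∂α₁ ∂α₁ := by
  rw [lintegral_map hF (by fun_prop), lintegral_prod _ (by fun_prop)]
  exact lintegral_congr fun x => lintegral_prod _ (by fun_prop)

lemma integral_map_triple {F : (Fin 3 → ℝ) → ℝ} (hF : Integrable F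
    ((α₁.prod (α₁.prod α₁)).map fun q => ![q.1 0, q.2.1 0, q.2.2 0])) :
    ∫ x, F x ∂(α₁.prod (α₁.prod α₁)).map (fun q => ![q.1 0, q.2.1 0, q.2.2 0])
      = ∫ x, ∫ y, ∫ z, F ![x 0, y 0, z 0] ∂α₁ ∂α₁ ∂α₁ := by
  have integrable_comp := hF.comp_measurable
    (f := fun q : (Fin 1 → ℝ) × (Fin 1 → ℝ) × (Fin 1 → ℝ) => ![q.1 0, q.2.1 0, q.2.2 0])
    (by fun_prop)
  rw [integral_map (by fun_prop) hF.aestronglyMeasurable,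
    integral_prod (fun q => F _) integrable_comp]
  refine integral_congr_ae ?_
  filter_upwards [integrable_comp.prod_right_ae] with x hx
  exact integral_prod _ hx

lemma map_pair_zero_one :
    (((α₁.prod α₁).map fun q => ![q.1 0, q.2 0]).prod α₁).map (fun q => ![q.1 0, q.1 1, q.2 0])
      = (α₁.prod (α₁.prod α₁)).map fun q => ![q.1 0, q.2.1 0, q.2.2 0] :=
  Measure.ext_of_lintegral _ fun F hF => by
    rw [lintegral_map_prod_pair_prod (by fun_prop) hF, lintegral_map_triple hF]
    rfl

lemma map_pair_zero_two :
    (((α₁.prod α₁).map fun q => ![q.1 0, q.2 0]).prod α₁).map (fun q => ![q.1 0, q.2 0, q.1 1])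
      = (α₁.prod (α₁.prod α₁)).map fun q => ![q.1 0, q.2.1 0, q.2.2 0] :=
  Measure.ext_of_lintegral _ fun F hF => by
    rw [lintegral_map_prod_pair_prod (by fun_prop) hF, lintegral_map_triple hF]
    exact lintegral_congr fun x => lintegral_lintegral_swap (by fun_prop)

lemma map_pair_one_two :
    (((α₁.prod α₁).map fun q => ![q.1 0, q.2 0]).prod α₁).map (fun q => ![q.2 0, q.1 0, q.1 1])
      = (α₁.prod (α₁.prod α₁)).map fun q => ![q.1 0, q.2.1 0, q.2.2 0] :=
  Measure.ext_of_lintegral _ fun F hF => by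
    rw [lintegral_map_prod_pair_prod (by fun_prop) hF, lintegral_map_triple hF]
    refine (lintegral_congr fun x => lintegral_lintegral_swap (by fun_prop)).trans ?_
    exact lintegral_lintegral_swap (by fun_prop)

lemma integral_integral_add_pair {e : (Fin 2 → ℝ) × (Fin 1 → ℝ) → Fin 3 → ℝ}
    (he : Measurable e) [IsLocallyFiniteMeasure ((β.prod α₁).map e)]
    (map_pair : (((α₁.prod α₁).map fun q => ![q.1 0, q.2 0]).prod α₁).map e
      = (α₁.prod (α₁.prod α₁)).map fun q => ![q.1 0, q.2.1 0, q.2.2 0])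
    {F : (Fin 3 → ℝ) → ℝ} (hF : Measurable F) (bounded : ∃ M : ℝ, ∀ t, |F t| ≤ M)
    (hc : HasCompactSupport F) :
    ∫ y, ∫ x, F (e (x, y)) ∂(β + (α₁.prod α₁).map fun q => ![q.1 0, q.2 0]) ∂α₁
      = ∫ x, F x ∂(β.prod α₁).map e
        + ∫ x, F x ∂(α₁.prod (α₁.prod α₁)).map fun q => ![q.1 0, q.2.1 0, q.2.2 0] := by
  have integrable (μ : Measure (Fin 3 → ℝ)) [IsLocallyFiniteMeasure μ] : Integrable F μ :=
    integrable_of_bounded_of_hasCompactSupport hF bounded hc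
  have map_add : ((β + (α₁.prod α₁).map fun q => ![q.1 0, q.2 0]).prod α₁).map e
      = (β.prod α₁).map e
        + (α₁.prod (α₁.prod α₁)).map fun q => ![q.1 0, q.2.1 0, q.2.2 0] := by
    rw [Measure.add_prod, Measure.map_add _ _ he, map_pair]
  rw [← integral_add_measure (integrable _) (integrable _), ← map_add]
  refine integral_integral_eq_integral_map he ?_
  rw [map_add]
  exact (integrable _).add_measure (integrable _)

end ThirdCumulant

section Cumulants

variable {Ω E L V : Type*}

/-- The points of all the configurations of `C` at the outcomes `ξ j`, labelled by `j` and the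
label they have there. -/
def PointFamily.superposition (C : PointFamily E V) (ξ : L → Ω → E) :
    PointFamily Ω (L × V) where
  present a := ξ a.1 ⁻¹' C.present a.2
  pos a ω := C.pos a.2 (ξ a.1 ω)

lemma PointFamily.lintegral_factorialPower_superposition (C : PointFamily E V) (ξ : L → Ω → E)
    (n : ℕ) (F : (Fin n → ℝ) → ℝ≥0∞) (ω : Ω) :
    ∫⁻ x, F x ∂(C.superposition ξ).factorialPower n ω
      = ∑' J : Fin n → L, C.jointSum J F fun j => ξ j ω := by
  classical
  rw [PointFamily.lintegral_factorialPower,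
    ← (Equiv.arrowProdEquivProdArrow _ (fun _ => L) fun _ => V).symm.tsum_eq, ENNReal.tsum_prod']
  refine tsum_congr fun J => tsum_congr fun v => ?_
  refine ite_congr (propext Iff.rfl) (fun _ => rfl) fun _ => rfl

variable [MeasurableSpace Ω] [MeasurableSpace E] {P : Measure Ω} {Θ : Measure E}
  {C : PointFamily E V} {ξ : L → Ω → E}

lemma PointFamily.IsMeasurable.superposition (hC : C.IsMeasurable) (hξ : ∀ j, Measurable (ξ j)) :
    (C.superposition ξ).IsMeasurable where
  measurableSet_present a := hξ a.1 (hC.measurableSet_present a.2)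
  measurable_pos a := (hC.measurable_pos a.2).comp (hξ a.1)

lemma PointFamily.IsMeasurable.lintegral_factorialMoment [Countable V] (hC : C.IsMeasurable) {n : ℕ}
    {F : (Fin n → ℝ) → ℝ≥0∞} (hF : Measurable F) :
    ∫⁻ x, F x ∂C.factorialMoment Θ n = ∫⁻ y, ∫⁻ x, F x ∂C.factorialPower n y ∂Θ :=
  Measure.lintegral_bind (hC.measurable_factorialPower n).aemeasurable hF.aemeasurable

section JointSum

variable [Countable V] (hC : C.IsMeasurable)

include hC

lemma lintegral_jointSum_const {n : ℕ} {F : (Fin n → ℝ) → ℝ≥0∞} (hF : Measurable F) :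
    ∫⁻ y, C.jointSum (fun _ => (0 : Fin 1)) F y ∂(Measure.pi fun _ => Θ)
      = ∫⁻ x, F x ∂C.factorialMoment Θ n := by
  rw [hC.lintegral_factorialMoment hF, ← (measurePreserving_funUnique Θ (Fin 1)).lintegral_comp_emb
    (MeasurableEquiv.measurableEmbedding _)]
  exact lintegral_congr fun y => C.jointSum_const 0 F y

variable [SigmaFinite Θ]

lemma lintegral_jointSum_fin_two {n a b : ℕ} {p : Fin n → Fin 2}
    {e : (Fin a → ℝ) × (Fin b → ℝ) → Fin n → ℝ} (he : Measurable e) {F : (Fin n → ℝ) → ℝ≥0∞}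
    (hF : Measurable F) (hp : ∀ y, C.jointSum p F y
      = ∫⁻ q, F (e q) ∂(C.factorialPower a (y 0)).prod (C.factorialPower b (y 1))) :
    ∫⁻ y, C.jointSum p F y ∂(Measure.pi fun _ => Θ)
      = ∫⁻ x, F x ∂((C.factorialMoment Θ a).prod (C.factorialMoment Θ b)).map e := by
  rw [lintegral_map hF he]
  refine Eq.trans ?_ (congrArg (fun μ => ∫⁻ q, F (e q) ∂μ)
    (prod_comp_comp (hC.factorialKernel a) (hC.factorialKernel b) Θ Θ)).symm
  rw [Measure.lintegral_bind (Kernel.aemeasurable _) (by fun_prop),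
    ← (measurePreserving_finTwoArrow Θ).lintegral_comp_emb (MeasurableEquiv.measurableEmbedding _)]
  refine lintegral_congr fun y => (hp y).trans ?_
  rw [Kernel.parallelComp_apply]
  rfl

lemma lintegral_jointSum_fin_three {F : (Fin 3 → ℝ) → ℝ≥0∞} (hF : Measurable F) :
    ∫⁻ y, C.jointSum id F y ∂(Measure.pi fun _ => Θ)
      = ∫⁻ x, F x ∂((C.factorialMoment Θ 1).prod
        ((C.factorialMoment Θ 1).prod (C.factorialMoment Θ 1))).map
          fun q => ![q.1 0, q.2.1 0, q.2.2 0] := by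
  let κ := hC.factorialKernel 1
  have prod_eq : (C.factorialMoment Θ 1).prod
      ((C.factorialMoment Θ 1).prod (C.factorialMoment Θ 1))
      = (κ ∥ₖ (κ ∥ₖ κ)) ∘ₘ (Θ.prod (Θ.prod Θ)) := by
    rw [← prod_comp_comp, ← prod_comp_comp]
    rfl
  have preserving : MeasurePreserving (fun y : Fin 3 → E => (y 0, y 1, y 2))
      (Measure.pi fun _ => Θ) (Θ.prod (Θ.prod Θ)) :=
    ((MeasurePreserving.id Θ).prod (measurePreserving_finTwoArrow Θ)).comp
      (measurePreserving_piFinSuccAbove (fun _ => Θ) 0)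
  rw [lintegral_map hF (by fun_prop), prod_eq, Measure.lintegral_bind (Kernel.aemeasurable _)
    (by fun_prop), ← preserving.map_eq, lintegral_map (by fun_prop) preserving.measurable]
  refine lintegral_congr fun y => (C.jointSum_zero_one_two hF y).trans ?_
  rw [Kernel.parallelComp_apply, Kernel.parallelComp_apply]
  rfl

end JointSum

variable [Countable V]

lemma tsum_lintegral_jointSum (hC : C.IsMeasurable) (hξ : ∀ j, Measurable (ξ j)) {r n : ℕ}
    (hΘ : (Measure.sum fun b : Fin r ↪ L => P.map fun ω i => ξ (b i) ω) = Measure.pi fun _ => Θ)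
    (p : Fin n → Fin r) {F : (Fin n → ℝ) → ℝ≥0∞} (hF : Measurable F) :
    ∑' b : Fin r ↪ L, ∫⁻ ω, C.jointSum (b ∘ p) F (fun j => ξ j ω) ∂P
      = ∫⁻ y, C.jointSum p F y ∂Measure.pi fun _ : Fin r => Θ := by
  rw [← hΘ, lintegral_sum_measure]
  refine tsum_congr fun b => ?_
  rw [lintegral_map (hC.measurable_jointSum p hF) (measurable_pi_lambda _ fun i => hξ (b i))]
  exact lintegral_congr fun ω => C.jointSum_comp b p F _

section Moments

variable [Countable L] (hC : C.IsMeasurable) (hξ : ∀ j, Measurable (ξ j))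

include hC hξ

lemma lintegral_factorialMoment_superposition {n : ℕ} {F : (Fin n → ℝ) → ℝ≥0∞}
    (hF : Measurable F) : ∫⁻ x, F x ∂(C.superposition ξ).factorialMoment P n
      = ∑' J : Fin n → L, ∫⁻ ω, C.jointSum J F (fun j => ξ j ω) ∂P := by
  rw [(hC.superposition hξ).lintegral_factorialMoment hF]
  simp only [PointFamily.lintegral_factorialPower_superposition]
  exact lintegral_tsum fun J =>
    ((hC.measurable_jointSum J hF).comp (measurable_pi_lambda _ hξ)).aemeasurable

variable (hΘ : ∀ r, (Measure.sum fun b : Fin r ↪ L => P.map fun ω i => ξ (b i) ω)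
    = Measure.pi fun _ => Θ)

include hΘ

lemma factorialMoment_superposition_one :
    (C.superposition ξ).factorialMoment P 1 = C.factorialMoment Θ 1 := by
  refine Measure.ext_of_lintegral _ fun F hF => ?_
  rw [lintegral_factorialMoment_superposition hC hξ hF, tsum_fin_one_fun_eq,
    tsum_lintegral_jointSum hC hξ (hΘ 1) _ hF, lintegral_jointSum_const hC hF]

lemma isLocallyFiniteMeasure_factorialMoment_superposition_one
    [IsLocallyFiniteMeasure (C.factorialMoment Θ 1)] :
    IsLocallyFiniteMeasure ((C.superposition ξ).factorialMoment P 1) := by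
  rwa [factorialMoment_superposition_one hC hξ hΘ]

variable [SigmaFinite Θ]

lemma factorialMoment_superposition_two :
    (C.superposition ξ).factorialMoment P 2 = C.factorialMoment Θ 2
      + ((C.factorialMoment Θ 1).prod (C.factorialMoment Θ 1)).map fun q => ![q.1 0, q.2 0] := by
  refine Measure.ext_of_lintegral _ fun F hF => ?_
  rw [lintegral_factorialMoment_superposition hC hξ hF, tsum_fin_two_fun_eq_add,
    lintegral_add_measure, tsum_lintegral_jointSum hC hξ (hΘ 1) _ hF,
    tsum_lintegral_jointSum hC hξ (hΘ 2) id hF, lintegral_jointSum_const hC hF,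
    lintegral_jointSum_fin_two hC (by fun_prop) hF fun y => C.jointSum_zero_one hF y]

lemma factorialMoment_superposition_three :
    (C.superposition ξ).factorialMoment P 3 = C.factorialMoment Θ 3
      + ((C.factorialMoment Θ 2).prod (C.factorialMoment Θ 1)).map (fun q => ![q.1 0, q.1 1, q.2 0])
      + ((C.factorialMoment Θ 2).prod (C.factorialMoment Θ 1)).map (fun q => ![q.1 0, q.2 0, q.1 1])
      + ((C.factorialMoment Θ 2).prod (C.factorialMoment Θ 1)).map (fun q => ![q.2 0, q.1 0, q.1 1])
      + ((C.factorialMoment Θ 1).prod ((C.factorialMoment Θ 1).prod (C.factorialMoment Θ 1))).map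
          fun q => ![q.1 0, q.2.1 0, q.2.2 0] := by
  refine Measure.ext_of_lintegral _ fun F hF => ?_
  simp only [lintegral_add_measure]
  rw [lintegral_factorialMoment_superposition hC hξ hF, tsum_fin_three_fun_eq_add,
    tsum_lintegral_jointSum hC hξ (hΘ 1) _ hF, tsum_lintegral_jointSum hC hξ (hΘ 2) _ hF,
    tsum_lintegral_jointSum hC hξ (hΘ 2) _ hF, tsum_lintegral_jointSum hC hξ (hΘ 2) _ hF,
    tsum_lintegral_jointSum hC hξ (hΘ 3) id hF, lintegral_jointSum_const hC hF,
    lintegral_jointSum_fin_two hC (by fun_prop) hF (C.jointSum_zero_zero_one hF),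
    lintegral_jointSum_fin_two hC (by fun_prop) hF (C.jointSum_zero_one_zero hF),
    lintegral_jointSum_fin_two hC (by fun_prop) hF (C.jointSum_one_zero_zero hF),
    lintegral_jointSum_fin_three hC hF]

section Cumulant

variable [IsLocallyFiniteMeasure (C.factorialMoment Θ 1)]
  [IsLocallyFiniteMeasure (C.factorialMoment Θ 2)]

lemma isLocallyFiniteMeasure_factorialMoment_superposition_two :
    IsLocallyFiniteMeasure ((C.superposition ξ).factorialMoment P 2) := by
  rw [factorialMoment_superposition_two hC hξ hΘ]
  infer_instance

variable [IsLocallyFiniteMeasure (C.factorialMoment Θ 3)]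

lemma isLocallyFiniteMeasure_factorialMoment_superposition_three :
    IsLocallyFiniteMeasure ((C.superposition ξ).factorialMoment P 3) := by
  rw [factorialMoment_superposition_three hC hξ hΘ]
  infer_instance

lemma thirdFactorialCumulant_superposition {F : (Fin 3 → ℝ) → ℝ} (hF : Measurable F)
    (bounded : ∃ M : ℝ, ∀ t, |F t| ≤ M) (hc : HasCompactSupport F) :
    (C.superposition ξ).thirdFactorialCumulant P F = ∫ x, F x ∂C.factorialMoment Θ 3 := by
  have integrable (μ : Measure (Fin 3 → ℝ)) [IsLocallyFiniteMeasure μ] : Integrable F μ :=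
    integrable_of_bounded_of_hasCompactSupport hF bounded hc
  rw [PointFamily.thirdFactorialCumulant, factorialMoment_superposition_one hC hξ hΘ,
    factorialMoment_superposition_two hC hξ hΘ, factorialMoment_superposition_three hC hξ hΘ,
    integral_add_measure (integrable _) (integrable _),
    integral_add_measure (integrable _) (integrable _),
    integral_add_measure (integrable _) (integrable _),
    integral_add_measure (integrable _) (integrable _),
    ← integral_map_triple (integrable _),
    integral_integral_add_pair (e := fun q => ![q.1 0, q.1 1, q.2 0]) (by fun_prop)
      map_pair_zero_one hF bounded hc,
    integral_integral_add_pair (e := fun q => ![q.1 0, q.2 0, q.1 1]) (by fun_prop)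
      map_pair_zero_two hF bounded hc,
    integral_integral_add_pair (e := fun q => ![q.2 0, q.1 0, q.1 1]) (by fun_prop)
      map_pair_one_two hF bounded hc]
  ring

end Cumulant

end Moments

end Cumulants

end Superposition

/-! ### Stationary superpositions -/

section Stationary

variable {E V : Type*}

/-- The configurations of `C`, translated by a variable amount. -/
def PointFamily.translate (C : PointFamily E V) : PointFamily (ℝ × E) V where
  present v := {y | y.2 ∈ C.present v}
  pos v y := y.1 + C.pos v y.2

lemma PointFamily.lintegral_factorialPower_translate (C : PointFamily E V) (n : ℕ)
    {F : (Fin n → ℝ) → ℝ≥0∞} (y : ℝ × E) :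
    ∫⁻ x, F x ∂C.translate.factorialPower n y
      = ∫⁻ x, F (fun k => y.1 + x k) ∂C.factorialPower n y.2 := by
  classical
  rw [PointFamily.lintegral_factorialPower, PointFamily.lintegral_factorialPower]
  exact tsum_congr fun v => ite_congr rfl (fun _ => rfl) fun _ => rfl

variable [MeasurableSpace E] {C : PointFamily E V} {G : Measure E}

lemma PointFamily.IsMeasurable.translate (hC : C.IsMeasurable) : C.translate.IsMeasurable where
  measurableSet_present v := measurable_snd (hC.measurableSet_present v)
  measurable_pos v := measurable_fst.add ((hC.measurable_pos v).comp measurable_snd)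

/-- The image of the third factorial moment measure under
`(x₀, x₁, x₂) ↦ (x₁ - x₀, x₂ - x₀)`. -/
def PointFamily.reducedThirdMoment (C : PointFamily E V) (G : Measure E) : Measure (ℝ × ℝ) :=
  (C.factorialMoment G 3).map fun x => (x 1 - x 0, x 2 - x 0)

lemma isNegInvariant_reducedThirdMoment [(C.factorialMoment G 3).IsNegInvariant] :
    (C.reducedThirdMoment G).IsNegInvariant := by
  refine ⟨?_⟩
  rw [Measure.neg, PointFamily.reducedThirdMoment, Measure.map_map (by fun_prop) (by fun_prop)]
  conv_rhs => rw [← Measure.neg_eq_self (C.factorialMoment G 3), Measure.neg,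
    Measure.map_map (by fun_prop) (by fun_prop)]
  congr 1 with x <;> simp <;> ring

variable [Countable V] (hC : C.IsMeasurable)

include hC

section Translate

variable {Λ : Measure ℝ} [SFinite Λ] [SFinite G]

section FactorialMoment

variable {n : ℕ} [SFinite (C.factorialMoment G n)]

lemma factorialMoment_translate :
    C.translate.factorialMoment (Λ.prod G) n
      = ((C.factorialMoment G n).prod Λ).map fun q k => q.2 + q.1 k := by
  refine Measure.ext_of_lintegral _ fun F hF => ?_
  have measurable_inner : Measurable fun y => ∫⁻ x, F x ∂C.translate.factorialPower n y :=
    (Measure.measurable_lintegral hF).comp (hC.translate.measurable_factorialPower n)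
  rw [hC.translate.lintegral_factorialMoment hF, lintegral_prod _ measurable_inner.aemeasurable,
    lintegral_map hF (by fun_prop), lintegral_prod_symm _ (by fun_prop)]
  simp only [PointFamily.lintegral_factorialPower_translate]
  exact lintegral_congr fun t =>
    (hC.lintegral_factorialMoment (F := fun x => F fun k => t + x k) (by fun_prop)).symm

lemma factorialMoment_translate_eq_map_sub [Λ.IsAddRightInvariant] (i : Fin n) :
    C.translate.factorialMoment (Λ.prod G) n
      = ((C.factorialMoment G n).prod Λ).map fun q k => q.2 + (q.1 k - q.1 i) := by
  have shear : MeasurePreserving (fun q : (Fin n → ℝ) × ℝ => (q.1, q.2 + q.1 i))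
      ((C.factorialMoment G n).prod Λ) ((C.factorialMoment G n).prod Λ) :=
    (MeasurePreserving.id _).skew_product (g := fun (x : Fin n → ℝ) t => t + x i) (by fun_prop)
      (.of_forall fun x => map_add_right_eq_self Λ (x i))
  conv_rhs => rw [← shear.map_eq, Measure.map_map (by fun_prop) (by fun_prop)]
  rw [factorialMoment_translate hC]
  congr 1 with q k
  simp only [Function.comp_apply]
  ring

lemma isLocallyFiniteMeasure_factorialMoment_translate [NeZero n] [Λ.IsAddRightInvariant]
    [IsLocallyFiniteMeasure Λ] [IsFiniteMeasure (C.factorialMoment G n)] :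
    IsLocallyFiniteMeasure (C.translate.factorialMoment (Λ.prod G) n) := by
  refine ⟨fun x => ⟨Metric.ball x 1, Metric.ball_mem_nhds x one_pos, ?_⟩⟩
  rw [factorialMoment_translate_eq_map_sub hC 0, Measure.map_apply (by fun_prop) measurableSet_ball]
  refine (measure_mono (t := univ ×ˢ Metric.ball (x 0) 1) fun q hq => ⟨mem_univ _, ?_⟩).trans_lt ?_
  · simpa using (dist_le_pi_dist _ x 0).trans_lt (mem_preimage.1 hq)
  · rw [Measure.prod_prod]
    exact ENNReal.mul_lt_top (measure_lt_top _ _) measure_ball_lt_top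

end FactorialMoment

lemma integral_factorialMoment_three_translate [Λ.IsAddRightInvariant]
    [IsFiniteMeasure (C.factorialMoment G 3)]
    {F : (Fin 3 → ℝ) → ℝ} (hF : Measurable F)
    (integrable : Integrable F (C.translate.factorialMoment (Λ.prod G) 3)) :
    ∫ x, F x ∂C.translate.factorialMoment (Λ.prod G) 3
      = ∫ t, ∫ τ, F ![t, t + τ.1, t + τ.2] ∂C.reducedThirdMoment G ∂Λ := by
  rw [factorialMoment_translate_eq_map_sub hC 0] at integrable ⊢
  rw [integral_map (by fun_prop) hF.aestronglyMeasurable,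
    integral_prod_symm (fun q => F _) (integrable.comp_measurable (by fun_prop))]
  refine integral_congr_ae (.of_forall fun t => ?_)
  simp only [PointFamily.reducedThirdMoment]
  rw [integral_map (by fun_prop) (Measurable.aestronglyMeasurable (by fun_prop))]
  refine integral_congr_ae (.of_forall fun x => congrArg F ?_)
  ext k
  fin_cases k <;> simp

end Translate

section Density

variable {Ω L : Type*} [MeasurableSpace Ω] [Countable L] {P : Measure Ω} {ξ : L → Ω → ℝ × E}
  {ν : ℝ≥0} [SigmaFinite G] [∀ n, IsFiniteMeasure (C.factorialMoment G n)]

lemma hasThirdCumulantDensity_translate_superposition (hξ : ∀ j, Measurable (ξ j))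
    (hΘ : ∀ r, (Measure.sum fun b : Fin r ↪ L => P.map fun ω i => ξ (b i) ω)
      = Measure.pi fun _ => (ν • volume).prod G)
    (reduced_ac : C.reducedThirdMoment G ≪ volume) :
    (C.translate.superposition ξ).HasThirdCumulantDensity P
      fun τ => ν * ((C.reducedThirdMoment G).rnDeriv volume τ).toReal := by
  have locallyFinite (n : ℕ) [NeZero n] : IsLocallyFiniteMeasure
      (C.translate.factorialMoment ((ν • volume).prod G) n) :=
    isLocallyFiniteMeasure_factorialMoment_translate hC
  have : IsFiniteMeasure (C.reducedThirdMoment G) := by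
    unfold PointFamily.reducedThirdMoment
    infer_instance
  refine ⟨isLocallyFiniteMeasure_factorialMoment_superposition_one hC.translate hξ hΘ,
    isLocallyFiniteMeasure_factorialMoment_superposition_two hC.translate hξ hΘ,
    isLocallyFiniteMeasure_factorialMoment_superposition_three hC.translate hξ hΘ,
    Measure.integrable_toReal_rnDeriv.const_mul _, fun F hF bounded hc => ?_⟩
  rw [thirdFactorialCumulant_superposition hC.translate hξ hΘ hF bounded hc,
    integral_factorialMoment_three_translate hC hF
      (integrable_of_bounded_of_hasCompactSupport hF bounded hc),
    integral_smul_nnreal_measure, NNReal.smul_def, ← integral_smul]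
  refine integral_congr_ae (.of_forall fun t => ?_)
  simp only [← integral_rnDeriv_smul reduced_ac, smul_eq_mul, ← integral_const_mul]
  exact integral_congr_ae (.of_forall fun τ => by ring)

end Density

end Stationary

section Bispectrum

lemma bispectrum_const_mul_rnDeriv {Q : Measure (ℝ × ℝ)} [SigmaFinite Q] (hQ : Q ≪ volume)
    (a w₁ w₂ : ℝ) :
    bispectrum (fun τ => a * (Q.rnDeriv volume τ).toReal) w₁ w₂
      = a * ∫ τ, Complex.exp (-Complex.I * ((w₁ * τ.1 + w₂ * τ.2 : ℝ) : ℂ)) ∂Q := by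
  rw [← integral_rnDeriv_smul hQ, ← integral_const_mul, bispectrum]
  refine integral_congr_ae (.of_forall fun τ => ?_)
  simp only [Complex.real_smul, Complex.ofReal_mul]
  ring

lemma im_integral_exp_eq_zero (Q : Measure (ℝ × ℝ)) [Q.IsNegInvariant] (w₁ w₂ : ℝ) :
    (∫ τ, Complex.exp (-Complex.I * ((w₁ * τ.1 + w₂ * τ.2 : ℝ) : ℂ)) ∂Q).im = 0 := by
  rw [← Complex.conj_eq_iff_im, ← integral_conj]
  refine (integral_congr_ae (.of_forall fun τ => ?_)).trans (integral_neg_eq_self _ Q)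
  simp only [← Complex.exp_conj, map_mul, map_neg, Complex.conj_I, Complex.conj_ofReal, neg_neg,
    Prod.fst_neg, Prod.snd_neg, mul_neg, ← neg_add, Complex.ofReal_neg, neg_mul]

lemma im_bispectrum_const_mul_rnDeriv {Q : Measure (ℝ × ℝ)} [SigmaFinite Q] [Q.IsNegInvariant]
    (hQ : Q ≪ volume) (a w₁ w₂ : ℝ) :
    (bispectrum (fun τ => a * (Q.rnDeriv volume τ).toReal) w₁ w₂).im = 0 := by
  rw [bispectrum_const_mul_rnDeriv hQ, Complex.im_ofReal_mul, im_integral_exp_eq_zero, mul_zero]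

end Bispectrum

/-! ### Clusters -/

section FamilyMoments

variable {E V : Type*}

lemma tsum_pow_eq_tsum_prod {α : Type*} (f : α → ℝ≥0∞) (n : ℕ) :
    (∑' a, f a) ^ n = ∑' v : Fin n → α, ∏ k, f (v k) := by
  induction n with
  | zero => simp
  | succ n ih =>
    rw [pow_succ', ih, ← (Fin.consEquiv fun _ => α).tsum_eq, ENNReal.tsum_prod',
      ← ENNReal.tsum_mul_right]
    refine tsum_congr fun a => ?_
    rw [← ENNReal.tsum_mul_left]
    exact tsum_congr fun v =>
      (Fin.prod_univ_succ fun k => f (Fin.cons (α := fun _ => α) a v k)).symm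

lemma PointFamily.counting_univ (X : PointFamily E V) (y : E) :
    X.counting y univ = ∑' v, (X.present v).indicator 1 y := by
  classical
  rw [PointFamily.counting, Measure.sum_apply _ .univ]
  refine tsum_congr fun v => ?_
  simp only [indicator_apply]
  split_ifs <;> simp

lemma PointFamily.factorialPower_univ_le (X : PointFamily E V) (n : ℕ) (y : E) :
    X.factorialPower n y univ ≤ X.counting y univ ^ n := by
  classical
  rw [← lintegral_one, X.lintegral_factorialPower, X.counting_univ, tsum_pow_eq_tsum_prod]
  refine ENNReal.tsum_le_tsum fun v => ?_
  split_ifs with h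
  · exact (Finset.prod_eq_one fun k _ => indicator_of_mem (h.2 k) 1).ge
  · exact zero_le

variable [MeasurableSpace E] [Countable V] {C : PointFamily E V} (hC : C.IsMeasurable)
  {G : Measure E}

include hC

lemma isFiniteMeasure_factorialMoment {n : ℕ} (hn : ∫⁻ y, C.counting y univ ^ n ∂G ≠ ∞) :
    IsFiniteMeasure (C.factorialMoment G n) := by
  refine ⟨?_⟩
  rw [← lintegral_one, hC.lintegral_factorialMoment measurable_const]
  simp only [lintegral_one]
  exact (lintegral_mono fun y => C.factorialPower_univ_le n y).trans_lt hn.lt_top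

lemma isNegInvariant_factorialMoment {T : E → E} (hT : MeasurePreserving T G G)
    (present_iff : ∀ v y, T y ∈ C.present v ↔ y ∈ C.present v)
    (pos_eq : ∀ v y, C.pos v (T y) = -C.pos v y) (n : ℕ) :
    (C.factorialMoment G n).IsNegInvariant := by
  classical
  refine ⟨Measure.ext_of_lintegral _ fun F hF => ?_⟩
  have measurable_inner : Measurable fun y => ∫⁻ x, F x ∂C.factorialPower n y :=
    (Measure.measurable_lintegral hF).comp (hC.measurable_factorialPower n)
  rw [Measure.neg, lintegral_map hF measurable_neg,
    hC.lintegral_factorialMoment (F := fun x => F (-x)) (by fun_prop),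
    hC.lintegral_factorialMoment hF, ← hT.lintegral_comp measurable_inner]
  refine lintegral_congr fun y => ?_
  simp only [C.lintegral_factorialPower, pos_eq]
  exact tsum_congr fun v => if_congr (and_congr_right' <|
    forall_congr' fun k => (present_iff (v k) y).symm) rfl rfl

lemma reducedThirdMoment_absolutelyContinuous {μ : Measure (ℝ × ℝ)}
    (h : ∀ u v w, u ≠ v → u ≠ w → v ≠ w →
      G.map (fun y => (C.pos v y - C.pos u y, C.pos w y - C.pos u y)) ≪ μ) :
    C.reducedThirdMoment G ≪ μ := by
  classical
  refine Measure.AbsolutelyContinuous.mk fun B hB h0 => ?_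
  have measurable_sub (u v w : V) :
      Measurable fun y => (C.pos v y - C.pos u y, C.pos w y - C.pos u y) :=
    ((hC.measurable_pos v).sub (hC.measurable_pos u)).prodMk
      ((hC.measurable_pos w).sub (hC.measurable_pos u))
  have notMem : ∀ᵐ y ∂G, ∀ v : Fin 3 → V, v.Injective →
      (C.pos (v 1) y - C.pos (v 0) y, C.pos (v 2) y - C.pos (v 0) y) ∉ B := by
    refine ae_all_iff.2 fun v => Filter.eventually_imp_distrib_left.2 fun hv => ?_
    have := h (v 0) (v 1) (v 2) (hv.ne (by decide)) (hv.ne (by decide)) (hv.ne (by decide)) h0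
    rw [Measure.map_apply (measurable_sub _ _ _) hB] at this
    exact measure_eq_zero_iff_ae_notMem.1 this
  rw [PointFamily.reducedThirdMoment, Measure.map_apply (by fun_prop) hB,
    ← lintegral_indicator_one (hB.preimage (by fun_prop)),
    hC.lintegral_factorialMoment (measurable_one.indicator (hB.preimage (by fun_prop)))]
  refine (lintegral_congr_ae ?_).trans lintegral_zero
  filter_upwards [notMem] with y hy
  rw [C.lintegral_factorialPower, ENNReal.tsum_eq_zero]
  intro v
  split_ifs with hv
  · exact indicator_of_notMem (hy v hv.1) 1
  · rfl

end FamilyMoments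

section InfinitePi

lemma map_update_infinitePi {ι : Type*} [DecidableEq ι] {X : ι → Type*}
    [∀ i, MeasurableSpace (X i)] (μ : ∀ i, Measure (X i)) [∀ i, IsProbabilityMeasure (μ i)]
    (i : ι) : ((Measure.infinitePi μ).prod (μ i)).map (fun q => Function.update q.1 i q.2)
      = Measure.infinitePi μ := by
  refine Measure.eq_infinitePi _ fun s t ht => ?_
  rw [Measure.map_apply measurable_update' (.pi s.countable_toSet fun j _ => ht j)]
  have preimage_eq : (fun q : (∀ j, X j) × X i => Function.update q.1 i q.2) ⁻¹' (s : Set ι).pi t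
      = ((s.erase i : Finset ι) : Set ι).pi t ×ˢ if i ∈ s then t i else univ := by
    ext ⟨x, y⟩
    simp only [mem_preimage, Set.mem_pi, mem_prod, Finset.mem_coe, Finset.mem_erase]
    refine ⟨fun h => ⟨fun j hj => by simpa [hj.1] using h j hj.2, ?_⟩, fun h j hj => ?_⟩
    · split_ifs with hi
      · simpa using h i hi
      · trivial
    · rcases eq_or_ne j i with rfl | hji
      · simpa [hj] using h.2
      · simpa [hji] using h.1 j ⟨hji, hj⟩
  rw [preimage_eq, Measure.prod_prod, Measure.infinitePi_pi _ fun j _ => ht j]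
  split_ifs with hi
  · rw [Finset.prod_erase_mul _ _ hi]
  · rw [measure_univ, mul_one, Finset.erase_eq_of_notMem hi]

lemma lintegral_prod_range_infinitePi {α : Type*} [MeasurableSpace α] (μ : Measure α)
    [IsProbabilityMeasure μ] {N : α → ℕ} (hN : Measurable N) {Z : α → ℝ≥0∞} (hZ : Measurable Z) :
    ∫⁻ ξ, ∏ i ∈ Finset.range (N (ξ none)), Z (ξ (some i))
        ∂Measure.infinitePi (fun _ : Option ℕ => μ)
      = ∫⁻ n, (∫⁻ x, Z x ∂μ) ^ n ∂μ.map N := by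
  classical
  set Q := Measure.infinitePi fun _ : Option ℕ => μ
  have measurable_prod : Measurable fun q : ℕ × (Option ℕ → α) =>
      ∏ i ∈ Finset.range q.1, Z (q.2 (some i)) :=
    measurable_from_prod_countable_right fun n =>
      Finset.measurable_fun_prod (Finset.range n) fun i _ => by fun_prop
  have lintegral_eval (i : ℕ) : ∫⁻ ξ, Z (ξ (some i)) ∂Q = ∫⁻ x, Z x ∂μ := by
    rw [← lintegral_map hZ (measurable_pi_apply _), Measure.infinitePi_map_eval]
  have lintegral_prod_range (n : ℕ) :
      ∫⁻ ξ, ∏ i ∈ Finset.range n, Z (ξ (some i)) ∂Q = (∫⁻ x, Z x ∂μ) ^ n := by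
    have indep : iIndepFun (fun (i : ℕ) (ξ : Option ℕ → α) => Z (ξ (some i))) Q :=
      (iIndepFun_infinitePi (X := fun _ => Z) fun _ => hZ).precomp (Option.some_injective ℕ)
    rw [lintegral_prod_eq_prod_lintegral_of_indepFun _ _ indep fun i => by fun_prop]
    simp only [lintegral_eval, Finset.prod_const, Finset.card_range]
  have measurable_integrand : Measurable fun ξ : Option ℕ → α =>
      ∏ i ∈ Finset.range (N (ξ none)), Z (ξ (some i)) :=
    measurable_prod.comp ((hN.comp (measurable_pi_apply none)).prodMk measurable_id)
  have map_update : (Q.prod μ).map (fun q => Function.update q.1 none q.2) = Q :=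
    map_update_infinitePi (fun _ : Option ℕ => μ) none
  rw [← map_update, lintegral_map measurable_integrand measurable_update']
  refine (lintegral_prod_symm _
    (measurable_integrand.comp measurable_update').aemeasurable).trans ?_
  simp only [Function.comp_apply, Function.update_self, ne_eq, reduceCtorEq, not_false_eq_true,
    Function.update_of_ne]
  simp only [lintegral_prod_range]
  exact (lintegral_map .of_discrete hN).symm

end InfinitePi

section Cluster

/-- The marks of a cluster: the number of children of each vertex and its displacement from its
parent. -/
abbrev ClusterMarks := List ℕ → ℕ × ℝ

/-- The vertices of the cluster with given marks whose root sits at the origin, as a point family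
on the space of marks. -/
def clusterFamily : PointFamily ClusterMarks (List ℕ) where
  present v := {k | InTree (fun w => (k w).1) v}
  pos v k := treePos (fun w => (k w).2) v

/-- The law of the marks of a cluster whose vertices have independent marks of law `β`. -/
def clusterLaw (β : Measure (ℕ × ℝ)) : Measure ClusterMarks := Measure.infinitePi fun _ => β

lemma clusterFamily_pos_cons (i : ℕ) (v : List ℕ) (k : ClusterMarks) :
    clusterFamily.pos (i :: v) k = clusterFamily.pos v k + (k (i :: v)).2 := rfl

lemma isMeasurable_clusterFamily : clusterFamily.IsMeasurable where
  measurableSet_present v := by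
    induction v with
    | nil => exact .univ
    | cons i v ih => exact (measurableSet_lt measurable_const (measurable_pi_apply v).fst).inter ih
  measurable_pos v := by
    induction v with
    | nil => exact measurable_const
    | cons i v ih => exact ih.add (measurable_pi_apply (i :: v)).snd

section Size

lemma inTree_append_singleton {K : List ℕ → ℕ} {v : List ℕ} {i : ℕ} :
    InTree K (v ++ [i]) ↔ i < K [] ∧ InTree (fun w => K (w ++ [i])) v := by
  induction v with
  | nil => simp [InTree]
  | cons j v ih => simp only [List.cons_append, InTree, ih]; tauto

lemma tsum_list_eq_add_tsum_append {α : Type*} (g : List α → ℝ≥0∞) :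
    ∑' v, g v = g [] + ∑' (i) (v), g (v ++ [i]) := by
  let e : Unit ⊕ α × List α ≃ List α :=
    { toFun := Sum.elim (fun _ => []) fun p => p.2 ++ [p.1]
      invFun := fun v => v.getLast?.elim (.inl ()) fun i => .inr (i, v.dropLast)
      left_inv := by rintro (_ | ⟨i, v⟩) <;> simp
      right_inv := by
        intro v
        rcases List.eq_nil_or_concat v with rfl | ⟨w, i, rfl⟩ <;> simp }
  rw [← e.tsum_eq, ENNReal.summable.tsum_sum ENNReal.summable, tsum_fintype,
    Fintype.sum_unique, ENNReal.tsum_prod']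
  rfl

/-- The number of vertices of a cluster in the generations up to the `n`-th one, computed by
recursion over the children of the root. -/
def truncatedSize : ℕ → ClusterMarks → ℕ
  | 0, _ => 1
  | n + 1, k => 1 + ∑ i ∈ Finset.range (k []).1, truncatedSize n fun w => k (w ++ [i])

lemma truncatedSize_eq_tsum (n : ℕ) (k : ClusterMarks) : (truncatedSize n k : ℝ≥0∞)
    = ∑' v : List ℕ, if v.length ≤ n then (clusterFamily.present v).indicator 1 k else 0 := by
  classical
  induction n generalizing k with
  | zero =>
    rw [tsum_eq_single [] fun v hv => by simp [hv]]
    simp [truncatedSize, clusterFamily, InTree]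
  | succ n ih =>
    have indicator_append (i : ℕ) (v : List ℕ) :
        (clusterFamily.present (v ++ [i])).indicator (1 : ClusterMarks → ℝ≥0∞) k
          = if i < (k []).1 then (clusterFamily.present v).indicator 1 (fun w => k (w ++ [i]))
            else 0 := by
      simp only [clusterFamily, indicator_apply, mem_ofPred_eq, inTree_append_singleton, ite_and,
        Pi.one_apply]
    rw [tsum_list_eq_add_tsum_append, truncatedSize, tsum_eq_sum (s := Finset.range (k []).1)]
    · push_cast
      simp only [ih, indicator_append]
      refine congr_arg₂ _ (by simp [clusterFamily, InTree])
        (Finset.sum_congr rfl fun i hi => tsum_congr fun v => ?_)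
      simp [Finset.mem_range.1 hi]
    · intro i hi
      simp [indicator_append, mt Finset.mem_range.2 hi]

lemma measurable_truncatedSize (n : ℕ) : Measurable (truncatedSize n) := by
  induction n with
  | zero => exact measurable_const
  | succ n ih =>
    have measurable_children : Measurable fun q : ℕ × ClusterMarks =>
        1 + ∑ i ∈ Finset.range q.1, truncatedSize n fun w => q.2 (w ++ [i]) :=
      measurable_from_prod_countable_right fun N => measurable_const.add <|
        Finset.measurable_fun_sum (Finset.range N) fun i _ => ih.comp (by fun_prop)
    exact measurable_children.comp ((measurable_pi_apply ([] : List ℕ)).fst.prodMk measurable_id)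

lemma tendsto_truncatedSize (k : ClusterMarks) :
    Filter.Tendsto (fun n => (truncatedSize n k : ℝ≥0∞)) .atTop
      (nhds (clusterFamily.counting k univ)) := by
  simp only [truncatedSize_eq_tsum, PointFamily.counting_univ]
  have monotone : Monotone fun n : ℕ => ∑' v : List ℕ,
      if v.length ≤ n then (clusterFamily.present v).indicator (1 : ClusterMarks → ℝ≥0∞) k
        else 0 := by
    refine fun a b hab => ENNReal.tsum_le_tsum fun v => ?_
    by_cases h : v.length ≤ a
    · simp [h, h.trans hab]
    · simp [h]
  convert tendsto_atTop_iSup monotone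
  refine le_antisymm ?_ (iSup_le fun n => ENNReal.tsum_le_tsum fun v => by split_ifs <;> simp)
  rw [ENNReal.tsum_eq_iSup_sum]
  refine iSup_le fun s => le_iSup_of_le (s.sup List.length) ?_
  refine le_trans (Finset.sum_le_sum fun v hv => ?_) (ENNReal.sum_le_tsum s)
  rw [if_pos (Finset.le_sup (f := List.length) hv)]

/-- The marks of a tree, given the marks `ξ none` of the root and the marks `ξ (some i)` of the
subtree of the `i`-th child; only the mark `ξ none []` of the root is used. -/
def assemble (ξ : Option ℕ → ClusterMarks) : ClusterMarks := fun v => ξ v.getLast? v.dropLast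

lemma measurable_assemble : Measurable assemble :=
  measurable_pi_lambda _ fun _ => (measurable_pi_apply _).comp (measurable_pi_apply _)

lemma truncatedSize_succ_assemble (n : ℕ) (ξ : Option ℕ → ClusterMarks) :
    truncatedSize (n + 1) (assemble ξ)
      = 1 + ∑ i ∈ Finset.range (ξ none []).1, truncatedSize n (ξ (some i)) := by
  have subtree_assemble (i : ℕ) : (fun w => assemble ξ (w ++ [i])) = ξ (some i) := by
    funext w
    simp [assemble]
  simp only [truncatedSize, subtree_assemble]
  rfl

variable {β : Measure (ℕ × ℝ)} [IsProbabilityMeasure β]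

instance : IsProbabilityMeasure (clusterLaw β) := by
  unfold clusterLaw
  infer_instance

lemma map_assemble :
    (Measure.infinitePi fun _ : Option ℕ => clusterLaw β).map assemble = clusterLaw β := by
  have injective : Function.Injective fun v : List ℕ => (v.getLast?, v.dropLast) := by
    intro v w h
    rcases List.eq_nil_or_concat v with rfl | ⟨v, i, rfl⟩ <;>
      rcases List.eq_nil_or_concat w with rfl | ⟨w, j, rfl⟩ <;> simp_all
  have map_reindex := Measure.map_infinitePi_infinitePi_of_inj
    (P := fun _ : Option ℕ × List ℕ => β) injective
  rwa [← Measure.infinitePi_map_curry_symm (fun (_ : Option ℕ) (_ : List ℕ) => β),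
    Measure.map_map (by fun_prop) (MeasurableEquiv.measurable _)] at map_reindex

lemma lintegral_pow_poissonMeasure (r : ℝ≥0) {y : ℝ} (hy : 0 ≤ y) :
    ∫⁻ n, ENNReal.ofReal y ^ n ∂poissonMeasure r = ENNReal.ofReal (Real.exp (r * (y - 1))) := by
  have hasSum : HasSum (fun n : ℕ => Real.exp (-r) * r ^ n / n.factorial * y ^ n)
      (Real.exp (r * (y - 1))) := by
    have := (NormedSpace.expSeries_div_hasSum_exp (r * y : ℝ)).mul_left (Real.exp (-r))
    rw [← Real.exp_eq_exp_ℝ, ← Real.exp_add] at this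
    have exponent_eq : (r : ℝ) * (y - 1) = -r + r * y := by ring
    rw [exponent_eq]
    refine this.congr_fun fun n => ?_
    rw [mul_pow]
    ring
  rw [lintegral_poissonMeasure, ← hasSum.tsum_eq,
    ENNReal.ofReal_tsum_of_nonneg (fun n => by positivity) hasSum.summable]
  exact tsum_congr fun n => by rw [← ENNReal.ofReal_pow hy, ← ENNReal.ofReal_mul (by positivity)]

lemma exists_natCast_pow_le_mul_pow {s : ℝ} (hs : 1 < s) (p : ℕ) :
    ∃ C : ℝ, ∀ n : ℕ, (n : ℝ≥0∞) ^ p ≤ ENNReal.ofReal C * ENNReal.ofReal s ^ n := by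
  obtain ⟨C, hC⟩ := (tendsto_pow_const_div_const_pow_of_one_lt p hs).bddAbove_range
  refine ⟨C, fun n => ?_⟩
  have := hC ⟨n, rfl⟩
  rw [div_le_iff₀ (by positivity)] at this
  rw [← ENNReal.ofReal_natCast, ← ENNReal.ofReal_pow (by positivity),
    ← ENNReal.ofReal_pow (by positivity), ← ENNReal.ofReal_mul' (by positivity)]
  exact ENNReal.ofReal_le_ofReal this

section Moments

variable {r : ℝ≥0} (hβ : β.map Prod.fst = poissonMeasure r)

include hβ

lemma lintegral_pow_truncatedSize_succ {s : ℝ≥0∞} (hs : s ≠ ∞) (n : ℕ) :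
    ∫⁻ k, s ^ truncatedSize (n + 1) k ∂clusterLaw β
      = s * ∫⁻ N, (∫⁻ k, s ^ truncatedSize n k ∂clusterLaw β) ^ N ∂poissonMeasure r := by
  have measurable_pow (n : ℕ) : Measurable fun k => s ^ truncatedSize n k :=
    (Measurable.of_discrete (f := fun n : ℕ => s ^ n)).comp (measurable_truncatedSize n)
  have measurable_offspring : Measurable fun k : ClusterMarks => (k []).1 := by fun_prop
  have map_offspring : (clusterLaw β).map (fun k => (k []).1) = poissonMeasure r := by
    have map_eval : (clusterLaw β).map (fun k => k []) = β :=
      Measure.infinitePi_map_eval (fun _ => β) []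
    rw [← hβ, ← map_eval, Measure.map_map measurable_fst (measurable_pi_apply _), map_eval]
    rfl
  conv_lhs => rw [← map_assemble, lintegral_map (measurable_pow _) measurable_assemble]
  simp only [truncatedSize_succ_assemble, pow_add, pow_one, ← Finset.prod_pow_eq_pow_sum]
  rw [lintegral_const_mul' _ _ hs,
    lintegral_prod_range_infinitePi (clusterLaw β) measurable_offspring (measurable_pow n),
    map_offspring]

lemma exists_one_lt_lintegral_pow_truncatedSize_le (hr : r < 1) : ∃ s B : ℝ, 1 < s ∧
    ∀ n, ∫⁻ k, ENNReal.ofReal s ^ truncatedSize n k ∂clusterLaw β ≤ ENNReal.ofReal B := by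
  have hr' : (r : ℝ) < 1 := by exact_mod_cast hr
  set δ : ℝ := (1 - r) / 2 with hδ
  have : 0 < δ := by linarith
  have hrδ : r * δ < 1 - r := by nlinarith
  -- With this value of `s`, the bound `1 + δ` is a fixed point of `y ↦ s * exp (r * (y - 1))`.
  refine ⟨(1 + δ) * Real.exp (-(r * δ)), 1 + δ, ?_, fun n => ?_⟩
  · calc 1 < (1 + δ) * (1 - r * δ) := by nlinarith
      _ ≤ (1 + δ) * Real.exp (-(r * δ)) := by gcongr; exact Real.one_sub_le_exp_neg _
  induction n with
  | zero =>
    simp only [truncatedSize, pow_one, lintegral_const, measure_univ, mul_one]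
    refine ENNReal.ofReal_le_ofReal (mul_le_of_le_one_right (by positivity) ?_)
    exact Real.exp_le_one_iff.2 (neg_nonpos.2 (by positivity))
  | succ n ih =>
    rw [lintegral_pow_truncatedSize_succ hβ ENNReal.ofReal_ne_top]
    calc ENNReal.ofReal ((1 + δ) * Real.exp (-(r * δ)))
          * ∫⁻ N, (∫⁻ k, ENNReal.ofReal ((1 + δ) * Real.exp (-(r * δ))) ^ truncatedSize n k
            ∂clusterLaw β) ^ N ∂poissonMeasure r
        ≤ ENNReal.ofReal ((1 + δ) * Real.exp (-(r * δ)))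
            * ∫⁻ N, ENNReal.ofReal (1 + δ) ^ N ∂poissonMeasure r := by gcongr
      _ = ENNReal.ofReal (1 + δ) := by
        rw [lintegral_pow_poissonMeasure r (by positivity), add_sub_cancel_left,
          ← ENNReal.ofReal_mul (by positivity), mul_assoc, ← Real.exp_add, neg_add_cancel,
          Real.exp_zero, mul_one]

lemma lintegral_counting_clusterFamily_pow_ne_top (hr : r < 1) (p : ℕ) :
    ∫⁻ k, clusterFamily.counting k univ ^ p ∂clusterLaw β ≠ ∞ := by
  obtain ⟨s, B, one_lt_s, lintegral_le⟩ := exists_one_lt_lintegral_pow_truncatedSize_le hβ hr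
  obtain ⟨C, hC⟩ := exists_natCast_pow_le_mul_pow one_lt_s p
  have measurable_pow (n : ℕ) : Measurable fun k => (truncatedSize n k : ℝ≥0∞) ^ p :=
    (Measurable.of_discrete (f := fun n : ℕ => (n : ℝ≥0∞) ^ p)).comp (measurable_truncatedSize n)
  have liminf_eq (k : ClusterMarks) :
      Filter.liminf (fun n => (truncatedSize n k : ℝ≥0∞) ^ p) .atTop
        = clusterFamily.counting k univ ^ p :=
    (((ENNReal.continuous_pow p).tendsto _).comp (tendsto_truncatedSize k)).liminf_eq
  have lintegral_truncatedSize_le (n : ℕ) :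
      ∫⁻ k, (truncatedSize n k : ℝ≥0∞) ^ p ∂clusterLaw β ≤ ENNReal.ofReal C * ENNReal.ofReal B :=
    calc ∫⁻ k, (truncatedSize n k : ℝ≥0∞) ^ p ∂clusterLaw β
        ≤ ∫⁻ k, ENNReal.ofReal C * ENNReal.ofReal s ^ truncatedSize n k ∂clusterLaw β :=
          lintegral_mono fun k => hC _
      _ = ENNReal.ofReal C * ∫⁻ k, ENNReal.ofReal s ^ truncatedSize n k ∂clusterLaw β :=
          lintegral_const_mul' _ _ ENNReal.ofReal_ne_top
      _ ≤ ENNReal.ofReal C * ENNReal.ofReal B := by gcongr; exact lintegral_le n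
  refine ne_top_of_le_ne_top (ENNReal.mul_ne_top ENNReal.ofReal_ne_top ENNReal.ofReal_ne_top) <|
    calc ∫⁻ k, clusterFamily.counting k univ ^ p ∂clusterLaw β
        = ∫⁻ k, Filter.liminf (fun n => (truncatedSize n k : ℝ≥0∞) ^ p) .atTop ∂clusterLaw β := by
          simp only [liminf_eq]
      _ ≤ Filter.liminf (fun n => ∫⁻ k, (truncatedSize n k : ℝ≥0∞) ^ p ∂clusterLaw β) .atTop :=
          lintegral_liminf_le measurable_pow
      _ ≤ ENNReal.ofReal C * ENNReal.ofReal B :=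
          Filter.liminf_le_of_le (by isBoundedDefault) fun b hb =>
            (hb.exists.choose_spec).trans (lintegral_truncatedSize_le _)

lemma isFiniteMeasure_factorialMoment_clusterFamily (hr : r < 1) (n : ℕ) :
    IsFiniteMeasure (clusterFamily.factorialMoment (clusterLaw β) n) :=
  isFiniteMeasure_factorialMoment isMeasurable_clusterFamily
    (lintegral_counting_clusterFamily_pow_ne_top hβ hr n)

end Moments

end Size

section Reflection

lemma measurePreserving_flipMarks {β : Measure (ℕ × ℝ)} [IsProbabilityMeasure β]
    (hβ : β.map (fun q => (q.1, -q.2)) = β) :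
    MeasurePreserving (fun (k : ClusterMarks) v => ((k v).1, -(k v).2)) (clusterLaw β)
      (clusterLaw β) := by
  have map_pi := Measure.infinitePi_map_pi (fun _ : List ℕ => β) (f := fun _ q => (q.1, -q.2))
    fun _ => by fun_prop
  simp only [hβ] at map_pi
  exact ⟨by fun_prop, map_pi⟩

lemma clusterFamily_pos_flipMarks (v : List ℕ) (k : ClusterMarks) :
    clusterFamily.pos v (fun w => ((k w).1, -(k w).2)) = -clusterFamily.pos v k := by
  induction v with
  | nil => exact neg_zero.symm
  | cons i v ih => rw [clusterFamily_pos_cons, clusterFamily_pos_cons, ih, neg_add]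

lemma isNegInvariant_factorialMoment_clusterFamily {β : Measure (ℕ × ℝ)} [IsProbabilityMeasure β]
    (hβ : β.map (fun q => (q.1, -q.2)) = β) (n : ℕ) :
    (clusterFamily.factorialMoment (clusterLaw β) n).IsNegInvariant :=
  isNegInvariant_factorialMoment isMeasurable_clusterFamily (measurePreserving_flipMarks hβ)
    (fun _ _ => Iff.rfl) clusterFamily_pos_flipMarks n

end Reflection

section RelativePositions

lemma map_prodMk_add_absolutelyContinuous {A T : Type*} [MeasurableSpace A] [MeasurableSpace T]
    {G : Measure A} [SFinite G] {δ : Measure ℝ} [SFinite δ] {μ : Measure T} [SFinite μ]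
    {Y : A → T} {Z : A → ℝ} (hY : Measurable Y) (hZ : Measurable Z) (hδ : δ ≪ volume)
    (hYμ : G.map Y ≪ μ) :
    (G.prod δ).map (fun q => (Y q.1, q.2 + Z q.1)) ≪ μ.prod volume := by
  have shear : MeasurePreserving (fun q : A × ℝ => (q.1, q.2 + Z q.1)) (G.prod volume)
      (G.prod volume) :=
    (MeasurePreserving.id G).skew_product (g := fun a x => x + Z a) (by fun_prop)
      (.of_forall fun a => map_add_right_eq_self volume (Z a))
  have map_eq : (G.prod volume).map (fun q => (Y q.1, q.2 + Z q.1)) = (G.map Y).prod volume :=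
    calc (G.prod volume).map (fun q => (Y q.1, q.2 + Z q.1))
        = ((G.prod volume).map fun q => (q.1, q.2 + Z q.1)).map (Prod.map Y id) := by
          rw [Measure.map_map (by fun_prop) (by fun_prop)]
          rfl
      _ = (G.map Y).prod volume := by
          rw [shear.map_eq, ← Measure.map_prod_map _ _ hY measurable_id, Measure.map_id]
  refine ((Measure.AbsolutelyContinuous.rfl.prod hδ).map (by fun_prop)).trans ?_
  rw [map_eq]
  exact hYμ.prod .rfl

lemma map_sub_sub_absolutelyContinuous_swap_right {A : Type*} [MeasurableSpace A] {G : Measure A}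
    {X Y Z : A → ℝ} (hX : Measurable X) (hY : Measurable Y) (hZ : Measurable Z)
    (h : G.map (fun a => (Y a - X a, Z a - X a)) ≪ volume) :
    G.map (fun a => (Z a - X a, Y a - X a)) ≪ volume := by
  have := h.map measurable_swap
  rwa [Measure.map_map measurable_swap (by fun_prop), Measure.volume_eq_prod,
    Measure.prod_swap] at this

lemma map_sub_sub_absolutelyContinuous_swap_left {A : Type*} [MeasurableSpace A] {G : Measure A}
    {X Y Z : A → ℝ} (hX : Measurable X) (hY : Measurable Y) (hZ : Measurable Z)
    (h : G.map (fun a => (Y a - X a, Z a - X a)) ≪ volume) :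
    G.map (fun a => (X a - Y a, Z a - Y a)) ≪ volume := by
  have shear : MeasurePreserving (fun p : ℝ × ℝ => (-p.1, p.2 - p.1)) volume volume :=
    (Measure.measurePreserving_neg volume).skew_product (g := fun x y => y - x) (by fun_prop)
      (.of_forall fun x => map_sub_right_eq_self volume x)
  have := h.map shear.measurable
  rw [Measure.map_map shear.measurable (by fun_prop), shear.map_eq] at this
  simpa [Function.comp_def] using this

lemma clusterFamily_pos_update_of_ne {v w : List ℕ} (h : v.length ≤ w.length) (hne : v ≠ w)
    (k : ClusterMarks) (q : ℕ × ℝ) :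
    clusterFamily.pos v (Function.update k w q) = clusterFamily.pos v k := by
  induction v with
  | nil => rfl
  | cons i v ih =>
    have length_lt : v.length < w.length := h
    rw [clusterFamily_pos_cons, clusterFamily_pos_cons, Function.update_of_ne hne,
      ih length_lt.le (by rintro rfl; exact length_lt.false)]

lemma clusterFamily_pos_update_self (i : ℕ) (v : List ℕ) (k : ClusterMarks) (q : ℕ × ℝ) :
    clusterFamily.pos (i :: v) (Function.update k (i :: v) q) = clusterFamily.pos v k + q.2 := by
  rw [clusterFamily_pos_cons, Function.update_self,
    clusterFamily_pos_update_of_ne (Nat.le_succ _) (List.cons_ne_self i v).symm]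

variable {β : Measure (ℕ × ℝ)} [IsProbabilityMeasure β] (hβ : β.map Prod.snd ≪ volume)

include hβ

lemma map_prodMk_pos_sub_absolutelyContinuous {T : Type*} [MeasurableSpace T] {μ : Measure T}
    [SFinite μ] {Y : ClusterMarks → T} {Z : ClusterMarks → ℝ} (hY : Measurable Y)
    (hZ : Measurable Z) {a : List ℕ} (ha : a ≠ [])
    (Y_update : ∀ k q, Y (Function.update k a q) = Y k)
    (Z_update : ∀ k q, Z (Function.update k a q) = Z k) (hYμ : (clusterLaw β).map Y ≪ μ) :
    (clusterLaw β).map (fun k => (Y k, clusterFamily.pos a k - Z k)) ≪ μ.prod volume := by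
  obtain ⟨i, v, rfl⟩ := List.exists_cons_of_ne_nil ha
  have measurable_pos := isMeasurable_clusterFamily.measurable_pos
  have measurable_shift : Measurable fun k => clusterFamily.pos v k - Z k :=
    (measurable_pos v).sub hZ
  have measurable_left : Measurable fun k => (Y k, clusterFamily.pos (i :: v) k - Z k) :=
    hY.prodMk ((measurable_pos _).sub hZ)
  have measurable_right : Measurable fun q : ClusterMarks × ℝ =>
      (Y q.1, q.2 + (clusterFamily.pos v q.1 - Z q.1)) :=
    (hY.comp measurable_fst).prodMk
      (measurable_snd.add (measurable_shift.comp measurable_fst))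
  have map_snd : (clusterLaw β).prod (β.map Prod.snd)
      = ((clusterLaw β).prod β).map (Prod.map id Prod.snd) := by
    rw [← Measure.map_prod_map _ _ measurable_id measurable_snd, Measure.map_id]
  have map_eq : (clusterLaw β).map (fun k => (Y k, clusterFamily.pos (i :: v) k - Z k))
      = ((clusterLaw β).prod (β.map Prod.snd)).map
        fun q => (Y q.1, q.2 + (clusterFamily.pos v q.1 - Z q.1)) := by
    have map_update : ((clusterLaw β).prod β).map (fun q => Function.update q.1 (i :: v) q.2)
        = clusterLaw β := map_update_infinitePi _ _
    conv_lhs => rw [← map_update, Measure.map_map measurable_left measurable_update']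
    rw [map_snd, Measure.map_map measurable_right (by fun_prop)]
    congr 1 with q
    · simp [Y_update]
    · simp [Z_update, clusterFamily_pos_update_self]
      ring
  rw [map_eq]
  exact map_prodMk_add_absolutelyContinuous hY measurable_shift hβ hYμ

lemma map_pos_sub_absolutelyContinuous {b c : List ℕ} (hcb : c.length ≤ b.length) (hne : c ≠ b) :
    (clusterLaw β).map (fun k => clusterFamily.pos b k - clusterFamily.pos c k) ≪ volume := by
  have measurable_pos := isMeasurable_clusterFamily.measurable_pos
  have measurable_diff : Measurable fun k => clusterFamily.pos b k - clusterFamily.pos c k :=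
    (measurable_pos b).sub (measurable_pos c)
  have hb : b ≠ [] := by
    rintro rfl
    exact hne (List.length_eq_zero_iff.1 (Nat.le_zero.1 hcb))
  have prod_ac := (map_prodMk_pos_sub_absolutelyContinuous hβ (μ := Measure.dirac ())
    (Y := fun _ => ()) measurable_const (measurable_pos c) hb (fun _ _ => rfl)
    (clusterFamily_pos_update_of_ne hcb hne) (by simp [Measure.AbsolutelyContinuous.rfl])).map
    measurable_snd
  rwa [← Measure.snd, ← Measure.snd, Measure.snd_prod, Measure.snd,
    Measure.map_map measurable_snd (measurable_const.prodMk measurable_diff)] at prod_ac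

lemma map_pos_sub_pos_sub_absolutelyContinuous_of_length_le {u v w : List ℕ}
    (huv : u.length ≤ v.length) (hvw : v.length ≤ w.length) (u_ne_v : u ≠ v) (u_ne_w : u ≠ w)
    (v_ne_w : v ≠ w) :
    (clusterLaw β).map (fun k => (clusterFamily.pos v k - clusterFamily.pos u k,
      clusterFamily.pos w k - clusterFamily.pos u k)) ≪ volume := by
  have measurable_pos := isMeasurable_clusterFamily.measurable_pos
  have hw : w ≠ [] := by
    rintro rfl
    exact v_ne_w (List.length_eq_zero_iff.1 (Nat.le_zero.1 hvw))
  have pos_v_update := clusterFamily_pos_update_of_ne hvw v_ne_w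
  have pos_u_update := clusterFamily_pos_update_of_ne (huv.trans hvw) u_ne_w
  exact map_prodMk_pos_sub_absolutelyContinuous hβ ((measurable_pos v).sub (measurable_pos u))
    (measurable_pos u) hw (fun k q => by simp only [Pi.sub_apply, pos_v_update, pos_u_update])
    pos_u_update (map_pos_sub_absolutelyContinuous hβ huv u_ne_v)

lemma map_pos_sub_pos_sub_absolutelyContinuous {u v w : List ℕ} (u_ne_v : u ≠ v) (u_ne_w : u ≠ w)
    (v_ne_w : v ≠ w) :
    (clusterLaw β).map (fun k => (clusterFamily.pos v k - clusterFamily.pos u k,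
      clusterFamily.pos w k - clusterFamily.pos u k)) ≪ volume := by
  have sorted {a b c : List ℕ} := map_pos_sub_pos_sub_absolutelyContinuous_of_length_le hβ
    (u := a) (v := b) (w := c)
  have measurable_pos := isMeasurable_clusterFamily.measurable_pos
  have swap_right {a b c : List ℕ} := map_sub_sub_absolutelyContinuous_swap_right
    (G := clusterLaw β) (measurable_pos a) (measurable_pos b) (measurable_pos c)
  have swap_left {a b c : List ℕ} := map_sub_sub_absolutelyContinuous_swap_left
    (G := clusterLaw β) (measurable_pos a) (measurable_pos b) (measurable_pos c)
  rcases le_total u.length v.length with huv | hvu <;>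
    rcases le_total v.length w.length with hvw | hwv <;>
    rcases le_total u.length w.length with huw | hwu
  · exact sorted huv hvw u_ne_v u_ne_w v_ne_w
  · exact sorted huv hvw u_ne_v u_ne_w v_ne_w
  · exact swap_right (sorted huw hwv u_ne_w u_ne_v v_ne_w.symm)
  · exact swap_right (swap_left (sorted hwu huv u_ne_w.symm v_ne_w.symm u_ne_v))
  · exact swap_left (sorted hvu huw u_ne_v.symm v_ne_w u_ne_w)
  · exact swap_left (swap_right (sorted hvw hwu v_ne_w u_ne_v.symm u_ne_w.symm))
  · exact swap_right (swap_left (swap_right (sorted hwv hvu v_ne_w.symm u_ne_w.symm u_ne_v.symm)))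
  · exact swap_right (swap_left (swap_right (sorted hwv hvu v_ne_w.symm u_ne_w.symm u_ne_v.symm)))

lemma reducedThirdMoment_clusterFamily_absolutelyContinuous :
    clusterFamily.reducedThirdMoment (clusterLaw β) ≪ volume :=
  reducedThirdMoment_absolutelyContinuous isMeasurable_clusterFamily fun _ _ _ =>
    map_pos_sub_pos_sub_absolutelyContinuous hβ

end RelativePositions

end Cluster

/-! ### Laplace functionals -/

section Laplace

open Filter Topology BoundedContinuousFunction

section ExpNeg

/-- The function `x ↦ exp (-x)` on `[0, ∞]`, with `exp (-∞) = 0`; it defines the Laplace functional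
of a random measure. -/
def expNeg (x : ℝ≥0∞) : ℝ≥0∞ := EReal.exp (-(x : EReal))

lemma continuous_expNeg : Continuous expNeg :=
  ENNReal.continuous_exp.comp (continuous_neg.comp continuous_coe_ennreal_ereal)

lemma measurable_expNeg : Measurable expNeg := continuous_expNeg.measurable

lemma measurable_expNeg_mul (y : ℝ≥0∞) : Measurable fun x => expNeg (y * x) :=
  measurable_expNeg.comp (measurable_const_mul y)

lemma antitone_expNeg : Antitone expNeg := fun _ _ h =>
  EReal.exp_monotone (EReal.neg_le_neg_iff.2 (EReal.coe_ennreal_le_coe_ennreal_iff.2 h))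

lemma expNeg_zero : expNeg 0 = 1 := by simp [expNeg]

lemma expNeg_le_one (x : ℝ≥0∞) : expNeg x ≤ 1 := expNeg_zero ▸ antitone_expNeg zero_le

lemma expNeg_ne_top (x : ℝ≥0∞) : expNeg x ≠ ∞ := ne_top_of_le_ne_top ENNReal.one_ne_top
  (expNeg_le_one x)

lemma expNeg_injective : Function.Injective expNeg := fun _ _ h =>
  EReal.coe_ennreal_injective (neg_injective (EReal.exp_strictMono.injective h))

lemma expNeg_add (x y : ℝ≥0∞) : expNeg (x + y) = expNeg x * expNeg y := by
  have exp_ne_zero (z : ℝ≥0∞) : EReal.exp (z : EReal) ≠ 0 :=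
    mt EReal.exp_eq_zero_iff.1 (EReal.coe_ennreal_ne_bot z)
  simp only [expNeg, EReal.exp_neg, EReal.coe_ennreal_add, EReal.exp_add]
  exact ENNReal.mul_inv (.inl (exp_ne_zero x)) (.inr (exp_ne_zero y))

lemma expNeg_sum {ι : Type*} (s : Finset ι) (f : ι → ℝ≥0∞) :
    expNeg (∑ i ∈ s, f i) = ∏ i ∈ s, expNeg (f i) := by
  induction s using Finset.cons_induction with
  | empty => simp [expNeg_zero]
  | cons i s hi ih => rw [Finset.sum_cons, Finset.prod_cons, expNeg_add, ih]

lemma expNeg_mul_natCast (x : ℝ≥0∞) (n : ℕ) : expNeg (x * n) = expNeg x ^ n := by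
  simpa [mul_comm] using expNeg_sum (Finset.range n) fun _ => x

lemma expNeg_ofReal {x : ℝ} (hx : 0 ≤ x) :
    expNeg (ENNReal.ofReal x) = ENNReal.ofReal (Real.exp (-x)) := by
  rw [expNeg, EReal.coe_ennreal_ofReal, max_eq_left hx, ← EReal.coe_neg, EReal.exp_coe]

/-- The function `y ↦ -log y` from `[0, 1]` to `[0, ∞]`, the inverse of `expNeg`; it vanishes for
`y ≥ 1`. -/
def negLog (y : ℝ≥0∞) : ℝ≥0∞ := (-(ENNReal.log y)).toENNReal

lemma measurable_negLog : Measurable negLog :=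
  measurable_ereal_toENNReal.comp (measurable_neg.comp ENNReal.measurable_log)

lemma expNeg_negLog {y : ℝ≥0∞} (hy : y ≤ 1) : expNeg (negLog y) = y := by
  have log_nonneg : 0 ≤ -(ENNReal.log y) := by
    rw [EReal.le_neg, neg_zero]
    exact ENNReal.log_le_zero_iff.2 hy
  rw [expNeg, negLog, EReal.coe_toENNReal log_nonneg, neg_neg, ENNReal.exp_log]

end ExpNeg

section Uniqueness

/-- The exponential functions `x ↦ exp (-∑ c_i x_i)` on `[0, ∞]^J`. They are multiplicative in
`c ∈ ℕ^J`, so that their linear combinations form an algebra. -/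
def expNegChar (J : Type*) [Fintype J] :
    Multiplicative (J → ℕ) →* ((J → ℝ≥0∞) →ᵇ ℝ) where
  toFun c := .ofNormedAddCommGroup (fun x => (expNeg (∑ i, (c.toAdd i : ℝ≥0∞) * x i)).toReal)
    (ENNReal.continuousOn_toReal.comp_continuous
      (continuous_expNeg.comp (continuous_finsetSum _ fun i _ =>
        (ENNReal.continuous_const_mul (ENNReal.natCast_ne_top _)).comp (continuous_apply i)))
      fun _ => expNeg_ne_top _) 1 fun x => by
      rw [Real.norm_of_nonneg ENNReal.toReal_nonneg]
      exact ENNReal.toReal_mono ENNReal.one_ne_top (expNeg_le_one _)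
  map_one' := by ext; simp [expNeg_zero]
  map_mul' c d := by ext; simp [add_mul, Finset.sum_add_distrib, expNeg_add]

variable {J : Type*} [Fintype J]

lemma expNegChar_apply (c : J → ℕ) (x : J → ℝ≥0∞) :
    expNegChar J (.ofAdd c) x = (expNeg (∑ i, (c i : ℝ≥0∞) * x i)).toReal := rfl

lemma measurable_expNeg_sum_mul (c : J → ℕ) :
    Measurable fun x : J → ℝ≥0∞ => expNeg (∑ i, (c i : ℝ≥0∞) * x i) :=
  measurable_expNeg.comp (by fun_prop)

/-- The algebra of linear combinations of the functions `expNegChar`. -/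
def expNegAlgebra (J : Type*) [Fintype J] : StarSubalgebra ℝ ((J → ℝ≥0∞) →ᵇ ℝ) where
  toSubalgebra := Algebra.adjoin ℝ (MonoidHom.mrange (expNegChar J))
  star_mem' {f} hf := by
    rwa [show star f = f by ext; simp]

lemma separatesPoints_expNegAlgebra :
    ((expNegAlgebra J).map (toContinuousMapStarₐ ℝ)).SeparatesPoints := by
  classical
  intro x y hxy
  obtain ⟨i, hi⟩ := Function.ne_iff.1 hxy
  refine ⟨_, ⟨_, ⟨expNegChar J (.ofAdd (Pi.single i 1)), Algebra.subset_adjoin ⟨_, rfl⟩, rfl⟩,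
    rfl⟩, fun h => hi (expNeg_injective ?_)⟩
  have sum_single (z : J → ℝ≥0∞) : ∑ k, ((Pi.single i 1 : J → ℕ) k : ℝ≥0∞) * z k = z i := by
    simp [Pi.single_apply]
  change expNegChar J _ x = expNegChar J _ y at h
  rwa [expNegChar_apply, expNegChar_apply, sum_single, sum_single,
    ENNReal.toReal_eq_toReal_iff' (expNeg_ne_top _) (expNeg_ne_top _)] at h

lemma ext_of_forall_lintegral_expNeg_sum {μ μ' : Measure (J → ℝ≥0∞)}
    [IsFiniteMeasure μ] [IsFiniteMeasure μ']
    (h : ∀ c : J → ℕ, ∫⁻ x, expNeg (∑ i, (c i : ℝ≥0∞) * x i) ∂μ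
      = ∫⁻ x, expNeg (∑ i, (c i : ℝ≥0∞) * x i) ∂μ') : μ = μ' := by
  have integral_char (c : J → ℕ) :
      ∫ x, expNegChar J (.ofAdd c) x ∂μ = ∫ x, expNegChar J (.ofAdd c) x ∂μ' := by
    simp only [expNegChar_apply]
    rw [integral_toReal (measurable_expNeg_sum_mul c).aemeasurable
        (.of_forall fun _ => (expNeg_ne_top _).lt_top),
      integral_toReal (measurable_expNeg_sum_mul c).aemeasurable
        (.of_forall fun _ => (expNeg_ne_top _).lt_top), h c]
  refine ext_of_forall_mem_subalgebra_integral_eq_of_polish separatesPoints_expNegAlgebra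
    fun g hg => ?_
  have mem_span : g ∈ Submodule.span ℝ (MonoidHom.mrange (expNegChar J) : Set _) := by
    rwa [← Submonoid.closure_eq (MonoidHom.mrange (expNegChar J)), ← Algebra.adjoin_eq_span]
  clear hg
  induction mem_span using Submodule.span_induction with
  | mem f hf =>
    obtain ⟨c, rfl⟩ := hf
    exact integral_char c.toAdd
  | zero => simp
  | add f g _ _ hf hg =>
    simp only [BoundedContinuousFunction.add_apply]
    rw [integral_add (f.integrable _) (g.integrable _),
      integral_add (f.integrable _) (g.integrable _), hf, hg]
  | smul a f _ hf =>
    simp only [BoundedContinuousFunction.smul_apply]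
    rw [integral_smul, integral_smul, hf]

variable {α : Type*} [MeasurableSpace α]

lemma ext_of_forall_map_eval {μ μ' : Measure (Measure α)} [IsFiniteMeasure μ] [IsFiniteMeasure μ']
    (h : ∀ J : Finset {A : Set α // MeasurableSet A},
      μ.map (fun N (A : J) => N A.1.1) = μ'.map (fun N (A : J) => N A.1.1)) : μ = μ' := by
  let eval (N : Measure α) (A : {A : Set α // MeasurableSet A}) : ℝ≥0∞ := N A.1
  have measurable_eval : Measurable eval :=
    measurable_pi_lambda _ fun A => Measure.measurable_coe A.2
  have le_comap_eval : (inferInstance : MeasurableSpace (Measure α)) ≤ .comap eval inferInstance :=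
    iSup₂_le fun A hA => MeasurableSpace.comap_le_iff_le_map.2 fun t ht =>
      ⟨_, measurable_pi_apply (⟨A, hA⟩ : {A : Set α // MeasurableSet A}) ht, rfl⟩
  have map_restrict (ρ : Measure (Measure α)) (J : Finset {A : Set α // MeasurableSet A}) :
      (ρ.map eval).map J.restrict = ρ.map fun N (A : J) => N A.1.1 :=
    Measure.map_map (Finset.measurable_restrict J) measurable_eval
  have map_eval : μ.map eval = μ'.map eval :=
    IsProjectiveLimit.unique (P := fun J => (μ.map eval).map J.restrict) (fun _ => rfl) fun J =>
      (map_restrict μ' J).trans ((h J).symm.trans (map_restrict μ J).symm)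
  ext s hs
  obtain ⟨t, ht, rfl⟩ := le_comap_eval s hs
  rw [← Measure.map_apply measurable_eval ht, map_eval, Measure.map_apply measurable_eval ht]

lemma ext_of_forall_lintegral_expNeg {μ μ' : Measure (Measure α)}
    [IsFiniteMeasure μ] [IsFiniteMeasure μ']
    (h : ∀ f : α → ℝ≥0∞, Measurable f →
      ∫⁻ N, expNeg (∫⁻ x, f x ∂N) ∂μ = ∫⁻ N, expNeg (∫⁻ x, f x ∂N) ∂μ') : μ = μ' := by
  refine ext_of_forall_map_eval fun J => ext_of_forall_lintegral_expNeg_sum fun c => ?_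
  have measurable_eval : Measurable fun (N : Measure α) (A : J) => N A.1.1 :=
    measurable_pi_lambda _ fun A => Measure.measurable_coe A.1.2
  have lintegral_step (N : Measure α) :
      ∫⁻ x, ∑ A : J, (c A : ℝ≥0∞) * A.1.1.indicator 1 x ∂N = ∑ A : J, (c A : ℝ≥0∞) * N A.1.1 := by
    rw [lintegral_finsetSum _ fun A _ => (measurable_one.indicator A.1.2).const_mul _]
    refine Finset.sum_congr rfl fun A _ => ?_
    rw [lintegral_const_mul _ (measurable_one.indicator A.1.2), lintegral_indicator_one A.1.2]
  rw [lintegral_map (measurable_expNeg_sum_mul c) measurable_eval,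
    lintegral_map (measurable_expNeg_sum_mul c) measurable_eval]
  simpa only [lintegral_step] using h (fun x => ∑ A : J, (c A : ℝ≥0∞) * A.1.1.indicator 1 x)
    (Finset.measurable_fun_sum _ fun A _ => (measurable_one.indicator A.1.2).const_mul _)

end Uniqueness

section Limits

variable {Ω E : Type*} [MeasurableSpace Ω] [MeasurableSpace E]

lemma tendsto_lintegral_expNeg_of_monotone {P : Measure Ω} [IsFiniteMeasure P] {N : Ω → Measure E}
    (hN : Measurable N) {f : ℕ → E → ℝ≥0∞} {g : E → ℝ≥0∞} (hf : ∀ n, Measurable (f n))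
    (hmono : Monotone f) (hlim : ∀ x, Tendsto (fun n => f n x) atTop (𝓝 (g x))) :
    Tendsto (fun n => ∫⁻ ω, expNeg (∫⁻ x, f n x ∂(N ω)) ∂P) atTop
      (𝓝 (∫⁻ ω, expNeg (∫⁻ x, g x ∂(N ω)) ∂P)) := by
  refine tendsto_lintegral_of_dominated_convergence (fun _ => 1)
    (fun n => measurable_expNeg.comp ((Measure.measurable_lintegral (hf n)).comp hN))
    (fun n => .of_forall fun ω => expNeg_le_one _) (by simp)
    (.of_forall fun ω => (continuous_expNeg.tendsto _).comp ?_)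
  exact lintegral_tendsto_of_tendsto_of_monotone (fun n => (hf n).aemeasurable)
    (.of_forall fun x n k hnk => hmono hnk x) (.of_forall hlim)

lemma tendsto_lintegral_one_sub_expNeg_of_monotone {Λ : Measure E} {f : ℕ → E → ℝ≥0∞}
    {g : E → ℝ≥0∞} (hf : ∀ n, Measurable (f n)) (hmono : Monotone f)
    (hlim : ∀ x, Tendsto (fun n => f n x) atTop (𝓝 (g x))) :
    Tendsto (fun n => ∫⁻ x, 1 - expNeg (f n x) ∂Λ) atTop (𝓝 (∫⁻ x, 1 - expNeg (g x) ∂Λ)) :=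
  lintegral_tendsto_of_tendsto_of_monotone
    (fun n => ((measurable_expNeg.comp (hf n)).const_sub 1).aemeasurable)
    (.of_forall fun x _ _ hnk => tsub_le_tsub_left (antitone_expNeg (hmono hnk x)) 1)
    (.of_forall fun x => ENNReal.Tendsto.sub tendsto_const_nhds
      ((continuous_expNeg.tendsto _).comp (hlim x)) (.inl ENNReal.one_ne_top))

lemma exists_monotone_simpleFunc_tendsto (Λ : Measure E) [SigmaFinite Λ] {g : E → ℝ≥0∞}
    (hg : Measurable g) :
    ∃ s : ℕ → SimpleFunc E ℝ≥0∞, (∀ n y, y ≠ 0 → Λ (s n ⁻¹' {y}) ≠ ∞) ∧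
      (Monotone fun n x => s n x) ∧ ∀ x, Tendsto (fun n => s n x) atTop (𝓝 (g x)) := by
  let s (n : ℕ) := (SimpleFunc.eapprox g n).restrict (spanningSets Λ n)
  have s_apply (n : ℕ) (x : E) :
      s n x = (spanningSets Λ n).indicator (SimpleFunc.eapprox g n) x :=
    SimpleFunc.restrict_apply _ (measurableSet_spanningSets Λ n) x
  refine ⟨s, fun n y hy => ?_, fun n k hnk x => ?_, fun x => ?_⟩
  · refine ((measure_mono fun x hx => ?_).trans_lt (measure_spanningSets_lt_top Λ n)).ne
    refine mem_of_indicator_ne_zero (f := SimpleFunc.eapprox g n) ?_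
    rwa [← s_apply, show s n x = y from hx]
  · simp only [s_apply]
    exact (indicator_le_indicator_of_subset (monotone_spanningSets Λ hnk)
      (fun _ => zero_le) x).trans (indicator_le_indicator (SimpleFunc.monotone_eapprox g hnk x))
  · refine (SimpleFunc.tendsto_eapprox hg x).congr' ?_
    filter_upwards [eventually_ge_atTop (spanningSetsIndex Λ x)] with n hn
    rw [s_apply, indicator_of_mem (mem_spanningSets_of_index_le Λ x hn)]

lemma lintegral_expNeg_tsum_infinitePi {L : Type*} [Countable L] {G : L → Measure E}
    [∀ j, IsProbabilityMeasure (G j)] {f : L → E → ℝ≥0∞} (hf : ∀ j, Measurable (f j)) :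
    ∫⁻ y, expNeg (∑' j, f j (y j)) ∂Measure.infinitePi G
      = expNeg (∑' j, negLog (∫⁻ y, expNeg (f j y) ∂G j)) := by
  have measurable_term (j : L) : Measurable fun y => expNeg (f j y) := measurable_expNeg.comp (hf j)
  have tendsto_prod (a : L → ℝ≥0∞) :
      Tendsto (fun s : Finset L => ∏ j ∈ s, expNeg (a j)) atTop (𝓝 (expNeg (∑' j, a j))) := by
    simp_rw [← expNeg_sum]
    exact (continuous_expNeg.tendsto _).comp ENNReal.summable.hasSum
  refine tendsto_nhds_unique (tendsto_lintegral_filter_of_dominated_convergence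
    (F := fun s (y : L → E) => ∏ j ∈ s, expNeg (f j (y j))) (fun _ => 1) (.of_forall fun s => ?_)
    (.of_forall fun s => .of_forall fun y => ?_) (by simp)
    (.of_forall fun y => tendsto_prod _)) ((tendsto_prod _).congr fun s => ?_)
  · exact Finset.measurable_fun_prod _ fun j _ => (measurable_term j).comp (measurable_pi_apply j)
  · exact Finset.prod_le_one' fun j _ => expNeg_le_one _
  · rw [lintegral_prod_eq_prod_lintegral_of_indepFun _
      (fun j (y : L → E) => expNeg (f j (y j))) (iIndepFun_infinitePi measurable_term)
      fun j => (measurable_term j).comp (measurable_pi_apply j)]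
    refine Finset.prod_congr rfl fun j _ => ?_
    rw [expNeg_negLog ((lintegral_mono fun y => expNeg_le_one _).trans (by simp))]
    exact ((measurePreserving_eval_infinitePi G j).lintegral_comp (measurable_term j)).symm

end Limits

section Poisson

variable {Ω : Type*} [MeasurableSpace Ω] {P : Measure Ω} {I : Ω → Measure ℝ} {Λ : Measure ℝ}

lemma lintegral_expNeg_mul_poissonMeasure (r : ℝ≥0) (y : ℝ≥0∞) :
    ∫⁻ n, expNeg (y * n) ∂poissonMeasure r = expNeg ((1 - expNeg y) * r) := by
  obtain ⟨t, ht, hy⟩ : ∃ t : ℝ, 0 ≤ t ∧ expNeg y = ENNReal.ofReal t :=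
    ⟨_, ENNReal.toReal_nonneg, (ENNReal.ofReal_toReal (expNeg_ne_top y)).symm⟩
  have ht_le : t ≤ 1 := by
    rw [← ENNReal.ofReal_le_one, ← hy]
    exact expNeg_le_one y
  simp only [expNeg_mul_natCast, hy]
  rw [lintegral_pow_poissonMeasure r ht, ← ENNReal.ofReal_one, ← ENNReal.ofReal_sub _ ht,
    ← ENNReal.ofReal_coe_nnreal, ← ENNReal.ofReal_mul (sub_nonneg.2 ht_le),
    expNeg_ofReal (mul_nonneg (sub_nonneg.2 ht_le) r.coe_nonneg)]
  congr 2
  ring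

variable (hI : IsPoissonProcess P I Λ)
include hI

lemma IsPoissonProcess.lintegral_expNeg_mul_count {A : Set ℝ} (hA : MeasurableSet A)
    (hΛ : Λ A ≠ ∞) (y : ℝ≥0∞) :
    ∫⁻ ω, expNeg (y * I ω A) ∂P = expNeg ((1 - expNeg y) * Λ A) := by
  have measurable_count : Measurable fun ω => I ω A :=
    (Measure.measurable_coe hA).comp hI.measurable
  rw [← lintegral_map (measurable_expNeg_mul y) measurable_count, hI.count A hA hΛ,
    lintegral_map (measurable_expNeg_mul y) (measurable_of_countable _),
    lintegral_expNeg_mul_poissonMeasure, ENNReal.coe_toNNReal hΛ]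

lemma IsPoissonProcess.lintegral_expNeg_simpleFunc (s : SimpleFunc ℝ ℝ≥0∞)
    (hs : ∀ y, y ≠ 0 → Λ (s ⁻¹' {y}) ≠ ∞) :
    ∫⁻ ω, expNeg (∫⁻ x, s x ∂(I ω)) ∂P = expNeg (∫⁻ x, 1 - expNeg (s x) ∂Λ) := by
  have indep := (hI.iIndepFun (fun y : s.range => s.measurableSet_fiber y.1)
    fun y y' hy => Disjoint.preimage _ (disjoint_singleton.2 fun h => hy (Subtype.ext h))).comp
      (fun y x => expNeg (y.1 * x)) fun y => measurable_expNeg_mul y.1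
  have integral_value (y : ℝ≥0∞) : ∫⁻ ω, expNeg (y * I ω (s ⁻¹' {y})) ∂P
      = expNeg ((1 - expNeg y) * Λ (s ⁻¹' {y})) := by
    obtain rfl | hy := eq_or_ne y 0
    · have := indep.isProbabilityMeasure
      simp [expNeg_zero]
    · exact hI.lintegral_expNeg_mul_count (s.measurableSet_fiber y) (hs y hy) y
  calc ∫⁻ ω, expNeg (∫⁻ x, s x ∂(I ω)) ∂P
    _ = ∫⁻ ω, ∏ y : s.range, expNeg (y.1 * I ω (s ⁻¹' {y.1})) ∂P := by
      refine lintegral_congr fun ω => ?_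
      rw [SimpleFunc.lintegral_eq_lintegral, SimpleFunc.lintegral, expNeg_sum,
        ← Finset.prod_coe_sort]
    _ = ∏ y : s.range, ∫⁻ ω, expNeg (y.1 * I ω (s ⁻¹' {y.1})) ∂P :=
      lintegral_prod_eq_prod_lintegral_of_indepFun _ _ indep fun y =>
        (measurable_expNeg_mul y.1).comp
          ((Measure.measurable_coe (s.measurableSet_fiber _)).comp hI.measurable)
    _ = ∏ y ∈ s.range, expNeg ((1 - expNeg y) * Λ (s ⁻¹' {y})) := by
      simp_rw [integral_value]
      exact Finset.prod_coe_sort s.range fun y => expNeg ((1 - expNeg y) * Λ (s ⁻¹' {y}))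
    _ = expNeg (∫⁻ x, 1 - expNeg (s x) ∂Λ) := by
      rw [← expNeg_sum, ← SimpleFunc.map_lintegral (fun y => 1 - expNeg y),
        ← SimpleFunc.lintegral_eq_lintegral]
      rfl

lemma IsPoissonProcess.lintegral_expNeg [IsFiniteMeasure P] [SigmaFinite Λ] {g : ℝ → ℝ≥0∞}
    (hg : Measurable g) :
    ∫⁻ ω, expNeg (∫⁻ x, g x ∂(I ω)) ∂P = expNeg (∫⁻ x, 1 - expNeg (g x) ∂Λ) := by
  obtain ⟨s, measure_fiber_ne_top, hmono, hlim⟩ := exists_monotone_simpleFunc_tendsto Λ hg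
  refine tendsto_nhds_unique (tendsto_lintegral_expNeg_of_monotone hI.measurable
    (fun n => (s n).measurable) hmono hlim) ?_
  simp_rw [hI.lintegral_expNeg_simpleFunc _ (measure_fiber_ne_top _)]
  exact (continuous_expNeg.tendsto _).comp
    (tendsto_lintegral_one_sub_expNeg_of_monotone (fun n => (s n).measurable) hmono hlim)

end Poisson

section Marked

variable {Ω E L : Type*} [MeasurableSpace Ω] [MeasurableSpace E] [Countable L]
  {P : Measure Ω} [IsFiniteMeasure P] {G : Measure E} [IsProbabilityMeasure G]
  {Λ : Measure ℝ} [SigmaFinite Λ]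
  {U : L → Ω → ℝ} {Y : L → Ω → E} (hU : ∀ j, Measurable (U j)) (hY : ∀ j, Measurable (Y j))
  (hI : IsPoissonProcess P (fun ω => Measure.sum fun j => Measure.dirac (U j ω)) Λ)
  (hUY : P.map (fun ω => (fun j => U j ω, fun j => Y j ω))
    = (P.map fun ω j => U j ω).prod (Measure.infinitePi fun _ => G))
include hU hY hI hUY

lemma IsPoissonProcess.sum_map_embedding_prodMk {ι : Type*} [Fintype ι] :
    (Measure.sum fun a : ι ↪ L => P.map fun ω i => (U (a i) ω, Y (a i) ω))
      = Measure.pi fun _ => Λ.prod G := by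
  have measurable_U : Measurable fun ω j => U j ω := measurable_pi_lambda _ hU
  have measurable_Y : Measurable fun ω j => Y j ω := measurable_pi_lambda _ hY
  have map_selection (a : ι ↪ L) : P.map (fun ω => (fun i => U (a i) ω, fun i => Y (a i) ω))
      = (P.map fun ω i => U (a i) ω).prod (Measure.pi fun _ => G) := by
    have map_marks := Measure.map_infinitePi_infinitePi_of_inj (P := fun _ : L => G) a.injective
    simp only [Measure.infinitePi_eq_pi] at map_marks
    have := congrArg (Measure.map (Prod.map (fun u i => u (a i)) fun y i => y (a i))) hUY
    rwa [Measure.map_map (by fun_prop) (measurable_U.prodMk measurable_Y),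
      ← Measure.map_prod_map _ _ (by fun_prop) (by fun_prop), map_marks,
      Measure.map_map (by fun_prop) measurable_U] at this
  have measurePreserving_symm :=
    (measurePreserving_arrowProdEquivProdArrow ℝ E ι (fun _ => Λ) fun _ => G).symm
  calc (Measure.sum fun a : ι ↪ L => P.map fun ω i => (U (a i) ω, Y (a i) ω))
    _ = Measure.sum fun a : ι ↪ L => ((P.map fun ω i => U (a i) ω).prod
          (Measure.pi fun _ => G)).map (MeasurableEquiv.arrowProdEquivProdArrow ℝ E ι).symm := by
      refine congrArg Measure.sum (funext fun a => ?_)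
      rw [← map_selection, Measure.map_map (by fun_prop) (by fun_prop)]
      rfl
    _ = ((Measure.sum fun a : ι ↪ L => P.map fun ω i => U (a i) ω).prod
          (Measure.pi fun _ => G)).map (MeasurableEquiv.arrowProdEquivProdArrow ℝ E ι).symm := by
      rw [Measure.prod_sum_left, Measure.map_sum (by fun_prop)]
    _ = Measure.pi fun _ => Λ.prod G := by
      rw [hI.sum_map_embedding hU, measurePreserving_symm.map_eq]

lemma IsPoissonProcess.lintegral_expNeg_tsum_prodMk {f : ℝ × E → ℝ≥0∞} (hf : Measurable f) :
    ∫⁻ ω, expNeg (∑' j, f (U j ω, Y j ω)) ∂P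
      = expNeg (∫⁻ z, 1 - expNeg (f z) ∂(Λ.prod G)) := by
  have measurable_U : Measurable fun ω j => U j ω := measurable_pi_lambda _ hU
  have measurable_expNeg_f : Measurable fun z => expNeg (f z) := measurable_expNeg.comp hf
  have measurable_section (u : ℝ) : Measurable fun y => expNeg (f (u, y)) :=
    measurable_expNeg_f.comp measurable_prodMk_left
  have measurable_tsum : Measurable fun q : (L → ℝ) × (L → E) =>
      expNeg (∑' j, f (q.1 j, q.2 j)) :=
    measurable_expNeg.comp (Measurable.tsum fun j => by fun_prop)
  let ψ (u : ℝ) : ℝ≥0∞ := ∫⁻ y, expNeg (f (u, y)) ∂G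
  have measurable_ψ : Measurable ψ := measurable_expNeg_f.lintegral_prod_right'
  have ψ_le_one (u : ℝ) : ψ u ≤ 1 := (lintegral_mono fun y => expNeg_le_one _).trans (by simp)
  have measurable_negLog_ψ : Measurable fun u => negLog (ψ u) := measurable_negLog.comp measurable_ψ
  have measurable_tsum_negLog : Measurable fun u : L → ℝ => expNeg (∑' j, negLog (ψ (u j))) :=
    measurable_expNeg.comp
      (Measurable.tsum fun j => measurable_negLog_ψ.comp (measurable_pi_apply j))
  calc ∫⁻ ω, expNeg (∑' j, f (U j ω, Y j ω)) ∂P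
    _ = ∫⁻ u, ∫⁻ y, expNeg (∑' j, f (u j, y j)) ∂(Measure.infinitePi fun _ => G)
          ∂(P.map fun ω j => U j ω) := by
      rw [← lintegral_prod _ measurable_tsum.aemeasurable, ← hUY,
        lintegral_map measurable_tsum (measurable_U.prodMk (measurable_pi_lambda _ hY))]
    _ = ∫⁻ u, expNeg (∑' j, negLog (ψ (u j))) ∂(P.map fun ω j => U j ω) :=
      lintegral_congr fun u => lintegral_expNeg_tsum_infinitePi (f := fun j y => f (u j, y))
        fun j => by fun_prop
    _ = ∫⁻ ω, expNeg (∫⁻ x, negLog (ψ x) ∂(Measure.sum fun j => Measure.dirac (U j ω))) ∂P := by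
      rw [lintegral_map measurable_tsum_negLog measurable_U]
      simp_rw [lintegral_sum_measure, lintegral_dirac' _ measurable_negLog_ψ]
    _ = expNeg (∫⁻ u, 1 - ψ u ∂Λ) := by
      rw [hI.lintegral_expNeg measurable_negLog_ψ]
      simp_rw [expNeg_negLog (ψ_le_one _)]
    _ = expNeg (∫⁻ z, 1 - expNeg (f z) ∂(Λ.prod G)) := by
      rw [lintegral_prod _ (measurable_expNeg_f.const_sub 1).aemeasurable]
      congr 1
      refine lintegral_congr fun u => ?_
      rw [lintegral_sub (measurable_section u) (ne_top_of_le_ne_top ENNReal.one_ne_top (ψ_le_one u))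
        (.of_forall fun y => expNeg_le_one _), lintegral_one, measure_univ]

end Marked

section Reversible

variable {Ω E L V : Type*} {C : PointFamily E V} {ξ : L → Ω → E}

lemma PointFamily.lintegral_counting (X : PointFamily E V) (f : ℝ → ℝ≥0∞) (y : E) :
    ∫⁻ x, f x ∂X.counting y = ∑' v, (X.present v).indicator (fun y => f (X.pos v y)) y := by
  classical
  rw [PointFamily.counting, lintegral_sum_measure]
  refine tsum_congr fun v => ?_
  simp only [Set.indicator_apply]
  split_ifs <;> simp

lemma PointFamily.lintegral_counting_superposition (f : ℝ → ℝ≥0∞) (ω : Ω) :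
    ∫⁻ x, f x ∂(C.superposition ξ).counting ω = ∑' j, ∫⁻ x, f x ∂C.counting (ξ j ω) := by
  simp only [PointFamily.lintegral_counting]
  exact ENNReal.tsum_prod'

variable [MeasurableSpace Ω] [MeasurableSpace E] [Countable L] [Countable V] {P : Measure Ω}
  [IsProbabilityMeasure P] {Θ : Measure E}

lemma isReversible_superposition (hC : C.IsMeasurable) (hξ : ∀ j, Measurable (ξ j))
    (hΘ : ∀ f : E → ℝ≥0∞, Measurable f →
      ∫⁻ ω, expNeg (∑' j, f (ξ j ω)) ∂P = expNeg (∫⁻ z, 1 - expNeg (f z) ∂Θ))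
    {S : E → E} (hS : MeasurePreserving S Θ Θ)
    (present_iff : ∀ v y, S y ∈ C.present v ↔ y ∈ C.present v)
    (pos_eq : ∀ v y, C.pos v (S y) = -C.pos v y) :
    IsReversible P (C.superposition ξ).counting := by
  have measurable_counting := (hC.superposition hξ).measurable_counting
  have measurable_neg_counting :
      Measurable fun ω => ((C.superposition ξ).counting ω).map fun x => -x :=
    (Measure.measurable_map _ measurable_neg).comp measurable_counting
  have measurable_sum {f : ℝ → ℝ≥0∞} (hf : Measurable f) :
      Measurable fun y => ∫⁻ x, f x ∂C.counting y :=
    (Measure.measurable_lintegral hf).comp hC.measurable_counting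
  have sum_comp_neg (f : ℝ → ℝ≥0∞) (y : E) :
      ∫⁻ x, f (-x) ∂C.counting y = ∫⁻ x, f x ∂C.counting (S y) := by
    classical
    simp only [PointFamily.lintegral_counting, Set.indicator_apply, present_iff, pos_eq]
  have laplace {f : ℝ → ℝ≥0∞} (hf : Measurable f) :
      ∫⁻ ω, expNeg (∫⁻ x, f x ∂(C.superposition ξ).counting ω) ∂P
        = expNeg (∫⁻ z, 1 - expNeg (∫⁻ x, f x ∂C.counting z) ∂Θ) := by
    simp_rw [PointFamily.lintegral_counting_superposition]
    exact hΘ _ (measurable_sum hf)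
  refine ⟨measurable_counting, ext_of_forall_lintegral_expNeg fun f hf => ?_⟩
  have measurable_laplace : Measurable fun N : Measure ℝ => expNeg (∫⁻ x, f x ∂N) :=
    measurable_expNeg.comp (Measure.measurable_lintegral hf)
  rw [lintegral_map measurable_laplace measurable_neg_counting,
    lintegral_map measurable_laplace measurable_counting, laplace hf]
  simp_rw [lintegral_map hf measurable_neg]
  rw [laplace (f := fun x => f (-x)) (by fun_prop)]
  simp_rw [sum_comp_neg]
  have measurable_deficit : Measurable fun z => 1 - expNeg (∫⁻ x, f x ∂C.counting z) :=
    (measurable_expNeg.comp (measurable_sum hf)).const_sub 1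
  rw [hS.lintegral_comp measurable_deficit]

end Reversible

end Laplace

/-! ### Poisson branching-cluster processes -/

section NegInvariant

variable {α : Type*} [MeasurableSpace α] [InvolutiveNeg α] [MeasurableNeg α] {μ : Measure α}
  [μ.IsNegInvariant]

lemma isNegInvariant_withDensity {f : α → ℝ≥0∞} (hf : ∀ x, f (-x) = f x) :
    (μ.withDensity f).IsNegInvariant := by
  refine ⟨Measure.ext fun s hs => ?_⟩
  have := (Measure.measurePreserving_neg μ).setLIntegral_comp_preimage_emb
    (MeasurableEquiv.neg α).measurableEmbedding f s
  simp only [hf] at this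
  rwa [Measure.neg, Measure.map_apply measurable_neg hs, withDensity_apply _ (measurable_neg hs),
    withDensity_apply _ hs]

lemma ae_rnDeriv_neg_eq {ν : Measure α} [ν.IsNegInvariant] [SigmaFinite μ] [SigmaFinite ν] :
    (fun x => μ.rnDeriv ν (-x)) =ᵐ[ν] μ.rnDeriv ν := by
  have := (MeasurableEquiv.neg α).measurableEmbedding.rnDeriv_map μ ν
  simpa only [MeasurableEquiv.neg_apply, Measure.map_neg_eq_self] using this

end NegInvariant

section MarkLaw

/-- The law of the mark of an individual: its number of children and its displacement from its
parent. -/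
def markLaw (m : ℝ≥0) (φ : ℝ → ℝ) : Measure (ℕ × ℝ) :=
  (poissonMeasure m).prod (volume.withDensity fun x => ENNReal.ofReal (φ x))

variable {m : ℝ≥0} {φ : ℝ → ℝ} {μ : Measure ℝ} (hφ : IsEvenDensityOf φ μ)
include hφ

lemma IsEvenDensityOf.isProbabilityMeasure :
    IsProbabilityMeasure (volume.withDensity fun x => ENNReal.ofReal (φ x)) :=
  ⟨by rw [withDensity_apply _ .univ, Measure.restrict_univ, hφ.lintegral_eq_one]⟩

lemma IsEvenDensityOf.isProbabilityMeasure_markLaw : IsProbabilityMeasure (markLaw m φ) := by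
  have := hφ.isProbabilityMeasure
  unfold markLaw
  infer_instance

lemma IsEvenDensityOf.map_fst_markLaw : (markLaw m φ).map Prod.fst = poissonMeasure m := by
  have := hφ.isProbabilityMeasure
  rw [markLaw, Measure.map_fst_prod, measure_univ, one_smul]

lemma IsEvenDensityOf.map_snd_markLaw_absolutelyContinuous :
    (markLaw m φ).map Prod.snd ≪ volume := by
  have := hφ.isProbabilityMeasure
  rw [markLaw, Measure.map_snd_prod, measure_univ, one_smul]
  exact withDensity_absolutelyContinuous _ _

lemma IsEvenDensityOf.map_neg_snd_markLaw :
    (markLaw m φ).map (fun q => (q.1, -q.2)) = markLaw m φ := by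
  have := hφ.isProbabilityMeasure
  have : (volume.withDensity fun x => ENNReal.ofReal (φ x)).IsNegInvariant :=
    isNegInvariant_withDensity fun x => by rw [hφ.even]
  exact ((MeasurePreserving.id _).prod (Measure.measurePreserving_neg _)).map_eq

end MarkLaw

section ClusterProcess

variable {Ω : Type*} {U : ℕ → Ω → ℝ} {K : ℕ × List ℕ → Ω → ℕ} {D : ℕ × List ℕ → Ω → ℝ}

/-- The marks of the cluster of the `j`-th immigrant. -/
def clusterMarks (K : ℕ × List ℕ → Ω → ℕ) (D : ℕ × List ℕ → Ω → ℝ) (j : ℕ) (ω : Ω) :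
    ClusterMarks := fun v => (K (j, v) ω, D (j, v) ω)

lemma clusterPoints_eq_superposition :
    clusterPoints U K D
      = clusterFamily.translate.superposition fun j ω => (U j ω, clusterMarks K D j ω) := rfl

variable [MeasurableSpace Ω] {P : Measure Ω} {ν m : ℝ≥0} {φ : ℝ → ℝ} {μ : Measure ℝ}

namespace IsBranchingClusterProcess

variable (hX : IsBranchingClusterProcess P ν m φ U K D)
include hX

lemma measurable_clusterMarks (j : ℕ) : Measurable (clusterMarks K D j) :=
  measurable_pi_lambda _ fun _ => (hX.measurable_K _).prodMk (hX.measurable_D _)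

lemma isPoissonProcess_immigrants :
    IsPoissonProcess P (fun ω => Measure.sum fun j => Measure.dirac (U j ω)) (ν • volume) := by
  have := hX.immigrants
  rwa [ENNReal.ofReal_coe_nnreal] at this

lemma map_clusterMarks [IsProbabilityMeasure (markLaw m φ)] :
    P.map (fun ω j => clusterMarks K D j ω)
      = Measure.infinitePi fun _ => clusterLaw (markLaw m φ) := by
  have measurable_mark (a : ℕ × List ℕ) : Measurable fun ω => (K a ω, D a ω) :=
    (hX.measurable_K a).prodMk (hX.measurable_D a)
  have map_mark (a : ℕ × List ℕ) : P.map (fun ω => (K a ω, D a ω)) = markLaw m φ := by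
    rw [hX.marks_law a, Real.toNNReal_coe, markLaw]
  have map_marks : P.map (fun ω a => (K a ω, D a ω)) = Measure.infinitePi fun _ => markLaw m φ := by
    rw [hX.marks_indep.map_fun_eq_infinitePi_map measurable_mark]
    simp only [map_mark]
  unfold clusterLaw
  rw [← Measure.infinitePi_map_curry (fun (_ : ℕ) (_ : List ℕ) => markLaw m φ), ← map_marks,
    Measure.map_map (MeasurableEquiv.measurable _) (measurable_pi_lambda _ measurable_mark)]
  rfl

lemma map_immigrants_clusterMarks [IsProbabilityMeasure P] [IsProbabilityMeasure (markLaw m φ)] :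
    P.map (fun ω => (fun j => U j ω, fun j => clusterMarks K D j ω))
      = (P.map fun ω j => U j ω).prod
          (Measure.infinitePi fun _ => clusterLaw (markLaw m φ)) := by
  have indep : IndepFun (fun ω j => U j ω) (fun ω j => clusterMarks K D j ω) P :=
    hX.immigrants_indep_marks.comp (φ := id)
      (ψ := fun (x : ℕ × List ℕ → ℕ × ℝ) j v => x (j, v)) measurable_id (by fun_prop)
  rw [← hX.map_clusterMarks]
  exact (indepFun_iff_map_prod_eq_prod_map_map
    (measurable_pi_lambda _ hX.measurable_U).aemeasurable
    (measurable_pi_lambda _ hX.measurable_clusterMarks).aemeasurable).1 indep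

variable [IsProbabilityMeasure P] (hφ : IsEvenDensityOf φ μ)
include hφ

lemma isReversible : IsReversible P (clusterPoints U K D).counting := by
  have := hφ.isProbabilityMeasure_markLaw (m := m)
  have reflection := ((Measure.measurePreserving_neg (volume : Measure ℝ)).smul_measure ν).prod
    (measurePreserving_flipMarks (hφ.map_neg_snd_markLaw (m := m)))
  rw [clusterPoints_eq_superposition]
  exact isReversible_superposition isMeasurable_clusterFamily.translate
    (fun j => (hX.measurable_U j).prodMk (hX.measurable_clusterMarks j))
    (fun f hf => hX.isPoissonProcess_immigrants.lintegral_expNeg_tsum_prodMk hX.measurable_U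
      hX.measurable_clusterMarks hX.map_immigrants_clusterMarks hf) reflection
    (fun _ _ => Iff.rfl) fun v y => by
      simp only [PointFamily.translate, Prod.map, clusterFamily_pos_flipMarks, neg_add]

lemma hasThirdCumulantDensity (hm : m < 1) :
    (clusterPoints U K D).HasThirdCumulantDensity P fun τ =>
      ν * ((clusterFamily.reducedThirdMoment (clusterLaw (markLaw m φ))).rnDeriv volume τ).toReal :=
  have := hφ.isProbabilityMeasure_markLaw (m := m)
  have := isFiniteMeasure_factorialMoment_clusterFamily (hφ.map_fst_markLaw (m := m)) hm
  hasThirdCumulantDensity_translate_superposition isMeasurable_clusterFamily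
    (fun j => (hX.measurable_U j).prodMk (hX.measurable_clusterMarks j))
    (fun r => hX.isPoissonProcess_immigrants.sum_map_embedding_prodMk hX.measurable_U
      hX.measurable_clusterMarks hX.map_immigrants_clusterMarks (ι := Fin r))
    (reducedThirdMoment_clusterFamily_absolutelyContinuous hφ.map_snd_markLaw_absolutelyContinuous)

end IsBranchingClusterProcess

lemma IsEvenDensityOf.im_bispectrum_cumulantDensity (hφ : IsEvenDensityOf φ μ) (hm : m < 1)
    (a w₁ w₂ : ℝ) :
    (bispectrum (fun τ => a * ((clusterFamily.reducedThirdMoment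
      (clusterLaw (markLaw m φ))).rnDeriv volume τ).toReal) w₁ w₂).im = 0 := by
  have := hφ.isProbabilityMeasure_markLaw (m := m)
  have := isFiniteMeasure_factorialMoment_clusterFamily (hφ.map_fst_markLaw (m := m)) hm 3
  have := isNegInvariant_factorialMoment_clusterFamily (hφ.map_neg_snd_markLaw (m := m)) 3
  have := isNegInvariant_reducedThirdMoment (C := clusterFamily)
    (G := clusterLaw (markLaw m φ))
  have : IsFiniteMeasure (clusterFamily.reducedThirdMoment (clusterLaw (markLaw m φ))) := by
    unfold PointFamily.reducedThirdMoment
    infer_instance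
  exact im_bispectrum_const_mul_rnDeriv (reducedThirdMoment_clusterFamily_absolutelyContinuous
    hφ.map_snd_markLaw_absolutelyContinuous) a w₁ w₂

end ClusterProcess

/-! ### The offspring law -/

section Weights

lemma matchProb_succ (m : ℝ) (n : ℕ) :
    matchProb m (n + 1) = 2 * catalan n * (m * (2 - m) / 4) ^ (n + 1) / m := by
  have centralBinom_eq : ((n + 1 : ℕ) : ℝ) * catalan n = n.centralBinom := by
    exact_mod_cast succ_mul_catalan_eq_centralBinom n
  have factorial_two_mul : (n.centralBinom : ℝ) * (n.factorial * n.factorial)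
      = (2 * n).factorial := by
    have := Nat.choose_mul_factorial_mul_factorial (show n ≤ 2 * n by omega)
    rw [show 2 * n - n = n by omega, mul_assoc] at this
    exact_mod_cast this
  have factorial_succ : ((n + 1).factorial : ℝ) = ((n + 1 : ℕ) : ℝ) * n.factorial := by
    exact_mod_cast Nat.factorial_succ n
  have factorial_ne_zero : (n.factorial : ℝ) ≠ 0 := by exact_mod_cast n.factorial_ne_zero
  have succ_ne_zero : ((n + 1 : ℕ) : ℝ) ≠ 0 := by exact_mod_cast n.succ_ne_zero
  rw [matchProb, show 2 * (n + 1) - 2 = 2 * n by omega, show 2 * (n + 1) - 1 = 2 * n + 1 by omega,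
    Nat.add_sub_cancel, ← factorial_two_mul, ← centralBinom_eq, factorial_succ, div_pow,
    pow_succ 2, pow_mul, show (2 : ℝ) ^ 2 = 4 by norm_num, pow_succ 4]
  field_simp
  ring

lemma sum_catalan_div_four_pow (N : ℕ) :
    ∑ n ∈ Finset.range N, 2 * (catalan n : ℝ) * (1 / 4) ^ (n + 1)
      = 1 - N.centralBinom * (1 / 4) ^ N := by
  induction N with
  | zero => simp
  | succ N ih =>
    have centralBinom_eq : ((N : ℝ) + 1) * catalan N = N.centralBinom := by
      exact_mod_cast succ_mul_catalan_eq_centralBinom N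
    have centralBinom_succ : ((N + 1).centralBinom : ℝ) = 2 * (2 * N + 1) * catalan N := by
      have : ((N : ℝ) + 1) * (N + 1).centralBinom = 2 * (2 * N + 1) * N.centralBinom := by
        exact_mod_cast Nat.succ_mul_centralBinom_succ N
      refine mul_left_cancel₀ (by positivity : (N : ℝ) + 1 ≠ 0) ?_
      rw [this, ← centralBinom_eq]
      ring
    rw [Finset.sum_range_succ, ih, centralBinom_succ, ← centralBinom_eq]
    ring

section Catalan

variable {x : ℝ} (hx₀ : 0 ≤ x) (hx₁ : x ≤ 1 / 4)
include hx₀ hx₁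

lemma sum_catalan_le_one (N : ℕ) :
    ∑ n ∈ Finset.range N, 2 * (catalan n : ℝ) * x ^ (n + 1) ≤ 1 :=
  calc ∑ n ∈ Finset.range N, 2 * (catalan n : ℝ) * x ^ (n + 1)
    _ ≤ ∑ n ∈ Finset.range N, 2 * (catalan n : ℝ) * (1 / 4) ^ (n + 1) := by gcongr
    _ = 1 - N.centralBinom * (1 / 4) ^ N := sum_catalan_div_four_pow N
    _ ≤ 1 := sub_le_self _ (by positivity)

lemma summable_catalan : Summable fun n => 2 * (catalan n : ℝ) * x ^ (n + 1) :=
  summable_of_sum_range_le (fun _ => by positivity) (sum_catalan_le_one hx₀ hx₁)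

lemma tsum_catalan_sq :
    (∑' n, 2 * (catalan n : ℝ) * x ^ (n + 1)) ^ 2
      = 2 * (∑' n, 2 * (catalan n : ℝ) * x ^ (n + 1)) - 4 * x := by
  have summable := summable_catalan hx₀ hx₁
  have sum_antidiagonal (n : ℕ) :
      ∑ kl ∈ Finset.HasAntidiagonal.antidiagonal n, (2 * (catalan kl.1 : ℝ) * x ^ (kl.1 + 1))
          * (2 * (catalan kl.2 : ℝ) * x ^ (kl.2 + 1))
        = 2 * (2 * (catalan (n + 1) : ℝ) * x ^ (n + 1 + 1)) := by
    rw [catalan_succ', Nat.cast_sum, Finset.mul_sum, Finset.sum_mul, Finset.mul_sum]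
    refine Finset.sum_congr rfl fun kl hkl => ?_
    rw [← Finset.HasAntidiagonal.mem_antidiagonal.1 hkl, Nat.cast_mul]
    ring
  rw [sq, tsum_mul_tsum_eq_tsum_sum_antidiagonal_of_summable_norm summable.norm summable.norm]
  simp_rw [sum_antidiagonal]
  rw [tsum_mul_left, summable.tsum_eq_zero_add, catalan_zero]
  ring

end Catalan

variable {m : ℝ}

lemma hasSum_catalan (hm₀ : 0 ≤ m) (hm₁ : m ≤ 1) :
    HasSum (fun n => 2 * (catalan n : ℝ) * (m * (2 - m) / 4) ^ (n + 1)) m := by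
  have hx₀ : 0 ≤ m * (2 - m) / 4 := div_nonneg (mul_nonneg hm₀ (by linarith)) (by norm_num)
  have hx₁ : m * (2 - m) / 4 ≤ 1 / 4 := by nlinarith [sq_nonneg (1 - m)]
  have summable := summable_catalan hx₀ hx₁
  have tsum_le_one := summable.tsum_le_of_sum_range_le (sum_catalan_le_one hx₀ hx₁)
  rw [summable.hasSum_iff]
  set S := ∑' n, 2 * (catalan n : ℝ) * (m * (2 - m) / 4) ^ (n + 1)
  have : (S - m) * (S - (2 - m)) = 0 := by
    linear_combination tsum_catalan_sq hx₀ hx₁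
  rcases mul_eq_zero.1 this with h | h <;> linarith

lemma matchProb_succ_nonneg (hm₀ : 0 ≤ m) (hm₁ : m ≤ 1) (n : ℕ) : 0 ≤ matchProb m (n + 1) := by
  rw [matchProb_succ]
  have : 0 ≤ 2 - m := by linarith
  positivity

lemma hasSum_matchProb (hm₀ : 0 < m) (hm₁ : m ≤ 1) : HasSum (fun n => matchProb m (n + 1)) 1 := by
  simpa only [matchProb_succ, div_self hm₀.ne'] using (hasSum_catalan hm₀.le hm₁).div_const m

end Weights

section Rho

variable {h : ℝ → ℝ} {m : ℝ}

/-- The convolution `h * ȟ`, where `ȟ(x) = h(-x)`. -/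
def selfCorrelation (h : ℝ → ℝ) (x : ℝ) : ℝ :=
  convolution h (fun y => h (-y)) (ContinuousLinearMap.mul ℝ ℝ) volume x

lemma selfCorrelation_apply (h : ℝ → ℝ) (x : ℝ) :
    selfCorrelation h x = ∫ t, h t * h (t - x) := by
  simp only [selfCorrelation, convolution_def, ContinuousLinearMap.mul_apply', neg_sub]

lemma selfCorrelation_neg (h : ℝ → ℝ) (x : ℝ) : selfCorrelation h (-x) = selfCorrelation h x := by
  rw [selfCorrelation_apply, selfCorrelation_apply,
    ← integral_sub_right_eq_self (fun t => h t * h (t - -x)) x]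
  simp only [sub_neg_eq_add, sub_add_cancel, mul_comm]

lemma rho_eq (m : ℝ) (h : ℝ → ℝ) (x : ℝ) :
    rho m h x = (h |x| - m * selfCorrelation h x) / (2 - m) := rfl

lemma rho_neg (m : ℝ) (h : ℝ → ℝ) (x : ℝ) : rho m h (-x) = rho m h x := by
  rw [rho_eq, rho_eq, abs_neg, selfCorrelation_neg]

namespace IsMonotoneKernel

variable (hh : IsMonotoneKernel h)
include hh

lemma integrable : Integrable h := by
  refine ⟨hh.measurable.aestronglyMeasurable, ?_⟩
  rw [hasFiniteIntegral_iff_ofReal (.of_forall hh.nonneg), hh.lintegral_eq_one]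
  exact ENNReal.one_lt_top

lemma integral_eq_one : ∫ x, h x = 1 := by
  rw [integral_eq_lintegral_of_nonneg_ae (.of_forall hh.nonneg) hh.measurable.aestronglyMeasurable,
    hh.lintegral_eq_one, ENNReal.toReal_one]

lemma integrable_selfCorrelation : Integrable (selfCorrelation h) :=
  hh.integrable.integrable_convolution (ContinuousLinearMap.mul ℝ ℝ) hh.integrable.comp_neg

lemma integral_selfCorrelation : ∫ x, selfCorrelation h x = 1 := by
  have := integral_convolution (ContinuousLinearMap.mul ℝ ℝ) hh.integrable hh.integrable.comp_neg
  rwa [integral_neg_eq_self, hh.integral_eq_one, ContinuousLinearMap.mul_apply', one_mul] at this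

lemma comp_abs_ae_eq : (fun x => h |x|) =ᵐ[volume] fun x => h x + h (-x) := by
  filter_upwards [Measure.ae_ne volume 0] with x hx
  rcases hx.lt_or_gt with h_neg | h_pos
  · rw [abs_of_neg h_neg, hh.eq_zero_of_neg x h_neg, zero_add]
  · rw [abs_of_pos h_pos, hh.eq_zero_of_neg (-x) (neg_neg_of_pos h_pos), add_zero]

lemma integrable_comp_abs : Integrable fun x => h |x| :=
  (hh.integrable.add hh.integrable.comp_neg).congr hh.comp_abs_ae_eq.symm

lemma integral_comp_abs : ∫ x, h |x| = 2 := by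
  rw [integral_congr_ae hh.comp_abs_ae_eq, integral_add hh.integrable hh.integrable.comp_neg,
    integral_neg_eq_self, hh.integral_eq_one, one_add_one_eq_two]

lemma integrable_rho : Integrable (rho m h) :=
  (hh.integrable_comp_abs.sub (hh.integrable_selfCorrelation.const_mul m)).div_const _

lemma integral_rho (hm : m ≠ 2) : ∫ x, rho m h x = 1 := by
  simp_rw [rho_eq]
  rw [integral_div, integral_sub hh.integrable_comp_abs (hh.integrable_selfCorrelation.const_mul m),
    integral_const_mul, hh.integral_selfCorrelation, hh.integral_comp_abs, mul_one,
    div_self (sub_ne_zero.2 hm.symm)]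

/-- On the support of `t ↦ h (t - x)` one has `t ≥ x`, hence `h t ≤ h x`. -/
lemma selfCorrelation_le_of_pos : ∀ᵐ x, 0 < x → selfCorrelation h x ≤ h x := by
  obtain ⟨g, hg, h_eq_g⟩ := hh.exists_antitone
  replace h_eq_g : ∀ᵐ x, 0 < x → h x = g x := (ae_restrict_iff' measurableSet_Ioi).1 h_eq_g
  filter_upwards [h_eq_g] with x hx x_pos
  calc selfCorrelation h x
    _ = ∫ t, h t * h (t - x) := selfCorrelation_apply h x
    _ ≤ ∫ t, h x * h (t - x) := by
      refine integral_mono_of_nonneg (.of_forall fun t => mul_nonneg (hh.nonneg _) (hh.nonneg _))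
        ((hh.integrable.comp_sub_right x).const_mul _) ?_
      filter_upwards [h_eq_g] with t ht
      rcases lt_or_ge t x with t_lt | x_le
      · simp only [hh.eq_zero_of_neg (t - x) (sub_neg.2 t_lt), mul_zero, le_refl]
      · refine mul_le_mul_of_nonneg_right ?_ (hh.nonneg _)
        rw [hx x_pos, ht (x_pos.trans_le x_le)]
        exact hg x_pos (x_pos.trans_le x_le) x_le
    _ = h x := by
      rw [integral_const_mul, integral_sub_right_eq_self, hh.integral_eq_one, mul_one]

lemma selfCorrelation_le_comp_abs : ∀ᵐ x, selfCorrelation h x ≤ h |x| := by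
  have le_of_pos := hh.selfCorrelation_le_of_pos
  filter_upwards [le_of_pos, Measure.ae_ne volume 0,
    (Measure.measurePreserving_neg (volume : Measure ℝ)).quasiMeasurePreserving.ae le_of_pos]
    with x le_of_pos x_ne_zero le_of_neg_pos
  rcases x_ne_zero.lt_or_gt with x_neg | x_pos
  · rw [abs_of_neg x_neg, ← selfCorrelation_neg]
    exact le_of_neg_pos (neg_pos.2 x_neg)
  · rw [abs_of_pos x_pos]
    exact le_of_pos x_pos

lemma rho_nonneg (hm₀ : 0 ≤ m) (hm₁ : m ≤ 1) : ∀ᵐ x, 0 ≤ rho m h x := by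
  filter_upwards [hh.selfCorrelation_le_comp_abs] with x hx
  refine div_nonneg (sub_nonneg.2 ?_) (by linarith)
  calc m * selfCorrelation h x
    _ ≤ m * h |x| := mul_le_mul_of_nonneg_left hx hm₀
    _ ≤ h |x| := mul_le_of_le_one_left (hh.nonneg _) hm₁

lemma isProbabilityMeasure_rho (hm₀ : 0 ≤ m) (hm₁ : m ≤ 1) :
    IsProbabilityMeasure (volume.withDensity fun x => ENNReal.ofReal (rho m h x)) := by
  constructor
  rw [withDensity_apply _ .univ, Measure.restrict_univ,
    ← ofReal_integral_eq_lintegral_ofReal hh.integrable_rho (hh.rho_nonneg hm₀ hm₁),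
    hh.integral_rho (by linarith), ENNReal.ofReal_one]

end IsMonotoneKernel

end Rho

section RandomSum

lemma exists_isEvenDensityOf {μ : Measure ℝ} [IsProbabilityMeasure μ] [μ.IsNegInvariant]
    (hμ : μ ≪ volume) : ∃ φ : ℝ → ℝ, IsEvenDensityOf φ μ := by
  let f (x : ℝ) := (μ.rnDeriv volume x).toReal
  have measurable_f : Measurable f := (Measure.measurable_rnDeriv μ volume).ennreal_toReal
  have ofReal_average_ae_eq :
      (fun x => ENNReal.ofReal ((f x + f (-x)) / 2)) =ᵐ[volume] μ.rnDeriv volume := by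
    filter_upwards [ae_rnDeriv_neg_eq (μ := μ) (ν := volume), Measure.rnDeriv_lt_top μ volume]
      with x hx lt_top
    simp only [f, hx, add_self_div_two, ENNReal.ofReal_toReal lt_top.ne]
  have eq_withDensity : μ = volume.withDensity fun x => ENNReal.ofReal ((f x + f (-x)) / 2) := by
    rw [withDensity_congr_ae ofReal_average_ae_eq, Measure.withDensity_rnDeriv_eq _ _ hμ]
  refine ⟨fun x => (f x + f (-x)) / 2, by fun_prop, fun x => by positivity, ?_, fun x => ?_,
    eq_withDensity⟩
  · rw [← setLIntegral_univ, ← withDensity_apply _ .univ, ← eq_withDensity, measure_univ]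
  · rw [neg_neg, add_comm]

lemma isNegInvariant_conv {G : Type*} [AddCommGroup G] [MeasurableSpace G] [MeasurableAdd₂ G]
    [MeasurableNeg G] {μ μ' : Measure G} [SFinite μ] [SFinite μ'] [μ.IsNegInvariant]
    [μ'.IsNegInvariant] : (μ.conv μ').IsNegInvariant := by
  refine ⟨?_⟩
  have := Measure.map_conv_addMonoidHom (μ := μ) (ν := μ') (negAddMonoidHom : G →+ G)
    measurable_neg
  rwa [coe_negAddMonoidHom, Measure.map_neg_eq_self μ, Measure.map_neg_eq_self μ'] at this

section ConvPow

variable {μ : Measure ℝ}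

instance [IsProbabilityMeasure μ] (n : ℕ) : IsProbabilityMeasure (convPow μ n) := by
  induction n with
  | zero => exact Measure.dirac.isProbabilityMeasure
  | succ n ih => exact Measure.probabilitymeasure_of_probabilitymeasures_conv _ _

variable [SFinite μ]

instance (n : ℕ) : SFinite (convPow μ n) := by
  induction n with
  | zero => exact inferInstanceAs (SFinite (Measure.dirac 0))
  | succ n ih => exact Measure.sfinite_conv_of_sfinite _ _

lemma isNegInvariant_convPow [μ.IsNegInvariant] (n : ℕ) : (convPow μ n).IsNegInvariant := by
  induction n with
  | zero => exact ⟨by rw [convPow, Measure.neg, Measure.map_dirac' measurable_neg, neg_zero]⟩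
  | succ n ih => exact isNegInvariant_conv

lemma convPow_succ_absolutelyContinuous (hμ : μ ≪ volume) (n : ℕ) : convPow μ (n + 1) ≪ volume :=
  Measure.conv_absolutelyContinuous hμ

end ConvPow

lemma randomSumLaw_absolutelyContinuous (m : ℝ) (h : ℝ → ℝ) : randomSumLaw m h ≪ volume :=
  Measure.absolutelyContinuous_sum_left fun n =>
    (convPow_succ_absolutelyContinuous (withDensity_absolutelyContinuous _ _) n).smul_left _

lemma isNegInvariant_randomSumLaw (m : ℝ) (h : ℝ → ℝ) : (randomSumLaw m h).IsNegInvariant := by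
  have : (volume.withDensity fun x => ENNReal.ofReal (rho m h x)).IsNegInvariant :=
    isNegInvariant_withDensity fun x => by rw [rho_neg]
  refine ⟨?_⟩
  rw [randomSumLaw, Measure.neg, Measure.map_sum measurable_neg.aemeasurable]
  have := isNegInvariant_convPow (μ := volume.withDensity fun x => ENNReal.ofReal (rho m h x))
  simp only [Measure.map_smul, Measure.map_neg_eq_self]

namespace IsMonotoneKernel

variable {h : ℝ → ℝ} {m : ℝ} (hh : IsMonotoneKernel h) (hm₀ : 0 < m) (hm₁ : m ≤ 1)
include hh hm₀ hm₁

lemma isProbabilityMeasure_randomSumLaw : IsProbabilityMeasure (randomSumLaw m h) := by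
  have := hh.isProbabilityMeasure_rho hm₀.le hm₁
  constructor
  rw [randomSumLaw, Measure.sum_apply _ .univ]
  simp only [Measure.smul_apply, measure_univ, smul_eq_mul, mul_one]
  rw [← ENNReal.ofReal_tsum_of_nonneg (matchProb_succ_nonneg hm₀.le hm₁)
    (hasSum_matchProb hm₀ hm₁).summable, (hasSum_matchProb hm₀ hm₁).tsum_eq, ENNReal.ofReal_one]

lemma exists_isEvenDensityOf_randomSumLaw :
    ∃ φ : ℝ → ℝ, IsEvenDensityOf φ (randomSumLaw m h) :=
  have := hh.isProbabilityMeasure_randomSumLaw hm₀ hm₁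
  have := isNegInvariant_randomSumLaw m h
  exists_isEvenDensityOf (randomSumLaw_absolutelyContinuous m h)

end IsMonotoneKernel

end RandomSum

end BranchingMatch

end

open BranchingMatch in
theorem mainTheorem10_general {m ν : ℝ≥0} (hm : m < 1) {φ : ℝ → ℝ} {μ : Measure ℝ}
    (hφ : IsEvenDensityOf φ μ) {Ω : Type*} [MeasurableSpace Ω] {P : Measure Ω}
    [IsProbabilityMeasure P] {U : ℕ → Ω → ℝ} {K : ℕ × List ℕ → Ω → ℕ} {D : ℕ × List ℕ → Ω → ℝ}
    (hX : IsBranchingClusterProcess P ν m φ U K D) :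
    IsReversible P (clusterPoints U K D).counting ∧
      ∃ c : ℝ × ℝ → ℝ, (clusterPoints U K D).HasThirdCumulantDensity P c ∧
        ∀ w₁ w₂ : ℝ, (bispectrum c w₁ w₂).im = 0 :=
  ⟨hX.isReversible hφ, _, hX.hasThirdCumulantDensity hφ hm, hφ.im_bispectrum_cumulantDensity hm ν⟩

theorem mainTheorem10 (m ν : ℝ) (hm₀ : 0 < m) (hm₁ : m < 1) (hν : 0 < ν)
    (h : ℝ → ℝ) (hh : BranchingMatch.IsMonotoneKernel h) :
    (∃ φ : ℝ → ℝ, BranchingMatch.IsEvenDensityOf φ (BranchingMatch.randomSumLaw m h)) ∧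
    ∀ φ : ℝ → ℝ, BranchingMatch.IsEvenDensityOf φ (BranchingMatch.randomSumLaw m h) →
      ∀ (Ω : Type*) [MeasurableSpace Ω] (P : MeasureTheory.Measure Ω)
        [MeasureTheory.IsProbabilityMeasure P]
        (U : ℕ → Ω → ℝ) (K : ℕ × List ℕ → Ω → ℕ) (D : ℕ × List ℕ → Ω → ℝ),
        BranchingMatch.IsBranchingClusterProcess P ν m φ U K D →
          BranchingMatch.IsReversible P (BranchingMatch.clusterPoints U K D).counting ∧
          ∃ c : ℝ × ℝ → ℝ,
            (BranchingMatch.clusterPoints U K D).HasThirdCumulantDensity P c ∧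
            ∀ w₁ w₂ : ℝ, (BranchingMatch.bispectrum c w₁ w₂).im = 0 :=
  ⟨hh.exists_isEvenDensityOf_randomSumLaw hm₀ hm₁.le, fun φ hφ Ω _ P _ U K D hX => by
    lift m to ℝ≥0 using hm₀.le
    lift ν to ℝ≥0 using hν.le
    exact mainTheorem10_general (by exact_mod_cast hm₁) hφ hX⟩
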